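/- Let $\Gamma$ be a finite graph cellularly embedded in a closed surface (loops, multiple edges and non-orientable surfaces are allowed), all of whose vertices have even degree greater than $2$, and which is bicolorable: its faces can be coloured with two colours so that the two sides of every edge differ. **The code.** Let $\Gamma_m^*$ be the dual of the medial graph of $\Gamma$ (vertices: the vertices and faces of $\Gamma$; edges: the corners of $\Gamma$; faces: the edges of $\Gamma$). Let $\Gamma_2$ be the 2-colex whose vertices are the flags of $\Gamma_m^*$, two flags being joined by a red, blue or green edge if they differ only in the vertex, only in the edge or only in the face. Its v-, e- and f-faces are the faces that come from the vertices, edges and faces of $\Gamma_m^*$; let $F_v$ and $F_f$ be the sets of v-faces that come from vertices and from faces of $\Gamma$. Inside every face in $F_v$ place an inner face with half as many vertices. Promote every blue edge on the boundary of a face in $F_v$ to a rank-3 edge by adding a vertex of the inner face, without crossings, and colour the edges of each inner face alternately red and green. Put qubits on the vertices of the resulting hypergraph $\mathcal H$. The edge operator $K_e$ is the product of $X$, $Y$ or $Z$ over the vertices of $e$ for $e$ red, green or blue. The gauge group $\mathcal G$ is generated by the $K_e$ of the rank-2 edges and the $Z_uZ_w$ with $u,w$ in a common rank-3 edge. Pauli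 operators are taken up to phase; the stabilizer is the centre of $\mathcal G$. A hypercycle is a set $\sigma$ of edges meeting every vertex an even number of times, and $W_\sigma=\prod_{e\in\sigma}K_e$. Consider the following cycles. - (S1) For a face $f\in F_f$: the edges on its boundary. - (S2) For a face in $F_v$: the green edges and the rank-3 edges on its boundary, and the green edges of its inner face. - (S3) For a face $f\in F_f$: the loop around $f$ on the far boundaries of the surrounding e-faces and f-faces. It consists of the green edges of the adjacent e-faces opposite to $f$, the rank-3 edges at their ends, the inner-face edge joining the two rank-3 edges at each such e-face, and, on each f-face adjacent to $f$, the blue edge on the opposite face of $F_f$ together with the two red edges at its ends. - (S4) For a face in $F_v$: the edges of its inner face. - (S5) For an e-face: the edges on its boundary. **Claim.** All these cycles are hypercycles and their operators $W_\sigma$ are stabilizers of the code. The unit cell of a face in $F_v$ consists of that face, its inner face and the adjacent e-faces. Call a set $\Omega$ of qubits a residual pattern if its qubits lie on boundaries of faces in $F_f$ (the outer boundaries of the unit cells) and it contains exactly one of the two such qubits of each e-face and exactly one end of each blue rank-2 edge. Residual patterns exist. Moreover $F_f$, identified with the set of faces of $\Gamma$, i.e. of vertices of the dual graph $\Gamma^*$,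 has a partition $F_f=F_a\sqcup F_b$ such that the following hold for every residual pattern $\Omega$. 1. Every Pauli error with trivial syndrome for all stabilizers of types S4, S5 and S2 (that is, after the $X$ errors and the $Z$ errors on rank-3 edges have been corrected) is equivalent modulo $\mathcal G$ to a $Z$ error $Z_A=\prod_{q\in A}Z_q$ with $A\subseteq\Omega$. 2. For $q\in\Omega$, the error $Z_q$ flips exactly one stabilizer of type S1, on a face $f$, and exactly one of type S3, on a face $f'$. Here $f\ne f'$, and $f,f'$ are the ends of the edge $\pi(q)$ of $\Gamma^*$, where $\pi(q)$ is dual to the edge of $\Gamma$ over whose f-face of $\Gamma_2$ the qubit $q$ lies. 3. $\Omega=\Omega_a\sqcup\Omega_b$, where $\pi$ maps each of $\Omega_a$ and $\Omega_b$ bijectively onto the edge set of $\Gamma^*$. Each $q\in\Omega_a$ has its S1 check on $F_a$ and its S3 check on $F_b$; each $q\in\Omega_b$ has its S3 check on $F_a$ and its S1 check on $F_b$. 4. Take two copies of the surface code on $\Gamma^*$ (qubits on edges; stabilizers generated by the vertex operators $A_v=\prod X_e$ over the edges at $v$ and the plaquette operators $B_p=\prod Z_e$ over the boundary of $p$, both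 with multiplicity). For $A\subseteq\Omega$, the S1 syndromes of $Z_A$ on $F_a$ and its S3 syndromes on $F_b$ are the vertex syndromes of $Z_{\pi(A\cap\Omega_a)}$ on the first copy. Its S3 syndromes on $F_a$ and S1 syndromes on $F_b$ are the vertex syndromes of $Z_{\pi(A\cap\Omega_b)}$ on the second copy. 5. The residual errors can be corrected on the two surface codes: if $D_a,D_b$ are sets of edges of $\Gamma^*$ such that $Z_{\pi(A\cap\Omega_a)}Z_{D_a}$ and $Z_{\pi(A\cap\Omega_b)}Z_{D_b}$ lie in the stabilizer of the surface code, and $\hat A=\{q\in\Omega_a:\pi(q)\in D_a\}\cup\{q\in\Omega_b:\pi(q)\in D_b\}$, then $Z_AZ_{\hat A}\in\mathcal G$. -/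

import Mathlib

open scoped Classical

/-! ### Pauli operators up to phase, edge-coloured hypergraphs and their subsystem codes -/

/-- Pauli operators on qubits indexed by `V`, up to a global phase. The pair `(x, z)` stands for
`∏ X_v ^ x v * Z_v ^ z v`; the product of operators is the sum of pairs, and the identity is `0`. -/
abbrev PauliOp (V : Type*) := (V → ZMod 2) × (V → ZMod 2)

/-- The commutation sign: `P Q = (-1) ^ (syn P Q) Q P`. This is also the syndrome bit obtained when
the operator `P` is measured after the error `Q`. -/
def PauliOp.syn {V : Type*} [Fintype V] (P Q : PauliOp V) : ZMod 2 :=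
  ∑ v, (P.1 v * Q.2 v + P.2 v * Q.1 v)

inductive EdgeColor
  | red
  | green
  | blue

/-- The single-qubit operator carried by a coloured edge at the qubit `v`:
`X` on red, `Y = i X Z` on green and `Z` on blue edges. -/
noncomputable def EdgeColor.pauli {V : Type*} (c : EdgeColor) (v : V) : PauliOp V :=
  match c with
  | .red => (Pi.single v 1, 0)
  | .green => (Pi.single v 1, Pi.single v 1)
  | .blue => (0, Pi.single v 1)

/-- The operator `Z` on every qubit of `A`. -/
noncomputable def zOn {V : Type*} (A : Finset V) : PauliOp V :=
  ∑ v ∈ A, EdgeColor.blue.pauli v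

/-- A coloured (hyper)edge: its set of vertices and its colour. In a properly edge-coloured
hypergraph an edge is determined by these two. -/
abbrev ColEdge (V : Type*) := Finset V × EdgeColor

/-- The edge operator `K_e`. -/
noncomputable def edgeOp {V : Type*} (e : ColEdge V) : PauliOp V :=
  ∑ v ∈ e.1, e.2.pauli v

/-- The gauge group of a coloured hypergraph: generated by the link operators. A rank-2 edge
`{u, w}` contributes its edge operator, a (blue) rank-3 edge the operators `Z_u Z_w` on the pairs
of its vertices. -/
def gaugeGroup {V : Type*} (H : Set (ColEdge V)) : AddSubgroup (PauliOp V) :=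
  AddSubgroup.closure
    {P | ∃ e ∈ H, ∃ u ∈ e.1, ∃ w ∈ e.1, u ≠ w ∧ P = e.2.pauli u + e.2.pauli w}

/-- Membership in the stabilizer of the subsystem code of `H` (the centre of the gauge group). -/
def IsStabilizer {V : Type*} [Fintype V] (H : Set (ColEdge V)) (P : PauliOp V) : Prop :=
  P ∈ gaugeGroup H ∧ ∀ g ∈ gaugeGroup H, PauliOp.syn P g = 0

/-- A hypercycle of `H`: a collection of edges meeting every vertex an even number of times. -/
def IsHypercycle {V : Type*} (H : Set (ColEdge V)) (σ : Finset (ColEdge V)) : Prop :=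
  (∀ e ∈ σ, e ∈ H) ∧ ∀ v, Even (σ.filter fun e => v ∈ e.1).card

/-- The cycle operator `W_σ`. -/
noncomputable def cycleOp {V : Type*} (σ : Finset (ColEdge V)) : PauliOp V :=
  ∑ e ∈ σ, edgeOp e

/-! ### Graphs embedded in closed surfaces -/

/-- A cellular embedding of a graph (loops and multiple edges allowed) in a closed surface, not
necessarily orientable, given by its flags (vertex, edge, face). The involution `τ i` changes the
`i`-dimensional cell of a flag and keeps the other two. -/
structure EmbGraph (F : Type*) where
  τ0 : F → F
  τ1 : F → F
  τ2 : F → F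
  inv0 : ∀ x, τ0 (τ0 x) = x
  inv1 : ∀ x, τ1 (τ1 x) = x
  inv2 : ∀ x, τ2 (τ2 x) = x
  ne0 : ∀ x, τ0 x ≠ x
  ne1 : ∀ x, τ1 x ≠ x
  ne2 : ∀ x, τ2 x ≠ x
  comm02 : ∀ x, τ0 (τ2 x) = τ2 (τ0 x)
  ne02 : ∀ x, τ0 (τ2 x) ≠ x

/-- Which of the two kinds of faces of a medial graph: those coming from vertices and those coming
from faces of the original graph. -/
inductive Side
  | vert
  | face

def Side.swap : Side → Side
  | .vert => .face
  | .face => .vert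

noncomputable instance : Fintype Side :=
  Fintype.ofList [.vert, .face] (by intro x; cases x <;> simp)

namespace EmbGraph

variable {F : Type*}

/-- The dual embedded graph. -/
def dual (M : EmbGraph F) : EmbGraph F where
  τ0 := M.τ2
  τ1 := M.τ1
  τ2 := M.τ0
  inv0 := M.inv2
  inv1 := M.inv1
  inv2 := M.inv0
  ne0 := M.ne2
  ne1 := M.ne1
  ne2 := M.ne0
  comm02 x := (M.comm02 x).symm
  ne02 x := by rw [← M.comm02]; exact M.ne02 x

/-- The medial graph. Its vertices are the edges, its edges the corners (incident pairs of a vertex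
and a face, at a given place), and its faces the vertices and the faces of `M`. The flag `(x, s)`
consists of the edge of `x`, the corner of `x`, and the vertex or face of `x` according to `s`. -/
def medial (M : EmbGraph F) : EmbGraph (F × Side) where
  τ0 x := (M.τ1 x.1, x.2)
  τ1 x := match x with
    | (y, .vert) => (M.τ2 y, .vert)
    | (y, .face) => (M.τ0 y, .face)
  τ2 x := (x.1, x.2.swap)
  inv0 x := by simp [M.inv1]
  inv1 x := by rcases x with ⟨y, _ | _⟩ <;> simp [M.inv2, M.inv0]
  inv2 x := by rcases x with ⟨y, _ | _⟩ <;> simp [Side.swap]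
  ne0 x := by rcases x with ⟨y, s⟩; simp [M.ne1]
  ne1 x := by rcases x with ⟨y, _ | _⟩ <;> simp [M.ne2, M.ne0]
  ne2 x := by rcases x with ⟨y, _ | _⟩ <;> simp [Side.swap]
  comm02 x := rfl
  ne02 x := by rcases x with ⟨y, s⟩; simp [M.ne1]

/-- Vertices: classes of flags under changes of the edge and of the face. -/
def Vertex (M : EmbGraph F) : Type _ := Quot fun x y => y = M.τ1 x ∨ y = M.τ2 x

/-- Edges: classes of flags under changes of the vertex and of the face. -/
def Edge (M : EmbGraph F) : Type _ := Quot fun x y => y = M.τ0 x ∨ y = M.τ2 x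

/-- Faces are the vertices of the dual. -/
abbrev Face (M : EmbGraph F) : Type _ := M.dual.Vertex

/-- Corners: incident pairs of a vertex and a face. -/
def Corner (M : EmbGraph F) : Type _ := Quot fun x y => y = M.τ1 x

/-- Half-edges: incident pairs of a vertex and an edge. -/
def HalfEdge (M : EmbGraph F) : Type _ := Quot fun x y => y = M.τ2 x

def vertexOf (M : EmbGraph F) (x : F) : M.Vertex := Quot.mk _ x
def edgeOf (M : EmbGraph F) (x : F) : M.Edge := Quot.mk _ x
abbrev faceOf (M : EmbGraph F) (x : F) : M.Face := M.dual.vertexOf x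
def cornerOf (M : EmbGraph F) (x : F) : M.Corner := Quot.mk _ x
def halfEdgeOf (M : EmbGraph F) (x : F) : M.HalfEdge := Quot.mk _ x

noncomputable instance [Fintype F] (M : EmbGraph F) : Fintype M.Edge :=
  Fintype.ofSurjective M.edgeOf Quot.mk_surjective

noncomputable instance [Fintype F] (M : EmbGraph F) : Fintype M.HalfEdge :=
  Fintype.ofSurjective M.halfEdgeOf Quot.mk_surjective

/-- The degree of a vertex (every half-edge at it carries two flags; a loop counts twice). -/
noncomputable def degree [Fintype F] (M : EmbGraph F) (v : M.Vertex) : ℕ :=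
  (Finset.univ.filter fun x => M.vertexOf x = v).card / 2

/-- The faces can be coloured with two colours so that the two sides of every edge differ; in other
words the dual graph is bipartite. -/
def Bicolorable (M : EmbGraph F) : Prop :=
  ∃ c : M.Face → Bool, ∀ x, c (M.faceOf x) ≠ c (M.faceOf (M.τ2 x))

/-- The edge `e` joins the vertices `v` and `w`. -/
def Joins (M : EmbGraph F) (e : M.Edge) (v w : M.Vertex) : Prop :=
  ∃ x, M.edgeOf x = e ∧ M.vertexOf x = v ∧ M.vertexOf (M.τ0 x) = w

/-! ### The surface code of an embedded graph (qubits on edges) -/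

/-- The vertex operator: `X` on the edges at `v`, a loop being counted twice. (Each incidence of an
edge with a vertex carries two flags.) -/
noncomputable def vertexOp [Fintype F] (M : EmbGraph F) (v : M.Vertex) : PauliOp M.Edge :=
  (fun e => (((Finset.univ.filter fun x => M.vertexOf x = v ∧ M.edgeOf x = e).card / 2 : ℕ) :
    ZMod 2), 0)

/-- The plaquette operator: `Z` on the boundary edges of `f`, an edge with `f` on both sides being
counted twice. -/
noncomputable def plaquetteOp [Fintype F] (M : EmbGraph F) (f : M.Face) : PauliOp M.Edge :=
  (0, fun e => (((Finset.univ.filter fun x => M.faceOf x = f ∧ M.edgeOf x = e).card / 2 : ℕ) :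
    ZMod 2))

/-- The stabilizer of the surface code on `M`. -/
def surfaceStabilizer [Fintype F] (M : EmbGraph F) : AddSubgroup (PauliOp M.Edge) :=
  AddSubgroup.closure (Set.range M.vertexOp ∪ Set.range M.plaquetteOp)

/-! ### The generalized five-squares hypergraph of `Γ = M` -/

/-- The dual of the medial graph of `M`. Its vertices are the vertices and faces of `M`, its edges
the corners and its faces the edges of `M`.

The 2-colex built from it has the flags of `M.medialDual` as vertices, and `x` is joined to `τ0 x`
by a red, to `τ1 x` by a blue and to `τ2 x` by a green edge. Its (red) v-faces, (blue) e-faces and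
(green) f-faces are the classes of flags under `⟨τ1, τ2⟩`, `⟨τ0, τ2⟩` and `⟨τ0, τ1⟩`, that is, they
come from the vertices, edges and faces of `M.medialDual`. -/
def medialDual (M : EmbGraph F) : EmbGraph (F × Side) := M.medial.dual

/-- The qubits: the vertices of the 2-colex, and for every promoted edge one new vertex on the inner
face. The promoted edges are the blue edges on the v-faces that come from vertices of `M`; they are
indexed by the half-edges of `M`. -/
abbrev Qubit (M : EmbGraph F) : Type _ := (F × Side) ⊕ M.HalfEdge

/-- Edges of the 2-colex joining v-faces; they lie on e-faces and are the outgoing edges of the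
v-faces. -/
noncomputable def redEdge (M : EmbGraph F) (x : F × Side) : ColEdge M.Qubit :=
  ({.inl x, .inl (M.medialDual.τ0 x)}, .red)

/-- Edges of the 2-colex between a v-face and an e-face. -/
noncomputable def greenEdge (M : EmbGraph F) (x : F × Side) : ColEdge M.Qubit :=
  ({.inl x, .inl (M.medialDual.τ2 x)}, .green)

/-- Unpromoted blue edges: those on the v-faces of the 2-colex that come from faces of `M`. -/
noncomputable def blueEdge (M : EmbGraph F) (x : F) : ColEdge M.Qubit :=
  ({.inl (x, .face), .inl (M.medialDual.τ1 (x, .face))}, .blue)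

/-- Rank-3 edges: a blue edge on a v-face that comes from a vertex of `M`, together with its new
vertex on the inner face. -/
noncomputable def hyperEdge (M : EmbGraph F) (x : F) : ColEdge M.Qubit :=
  ({.inl (x, .vert), .inl (M.medialDual.τ1 (x, .vert)), .inr (M.halfEdgeOf x)}, .blue)

/-- Edges of the inner faces, one for each corner of `M`, joining the new vertices of consecutive
promoted edges. The function `κ` tells which of them are green; the others are red. -/
noncomputable def innerEdge (M : EmbGraph F) (κ : F → Bool) (x : F) : ColEdge M.Qubit :=
  ({.inr (M.halfEdgeOf x), .inr (M.halfEdgeOf (M.τ1 x))}, if κ x then .green else .red)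

/-- `κ` is a function of the corner, and alternates along every inner face. -/
def IsInnerColoring (M : EmbGraph F) (κ : F → Bool) : Prop :=
  (∀ x, κ (M.τ1 x) = κ x) ∧ ∀ x, κ (M.τ2 x) = !κ x

/-- The generalized five-squares hypergraph. -/
def fiveSquares (M : EmbGraph F) (κ : F → Bool) : Set (ColEdge M.Qubit) :=
  Set.range M.redEdge ∪ Set.range M.greenEdge ∪ Set.range M.blueEdge ∪
    Set.range M.hyperEdge ∪ Set.range (M.innerEdge κ)

section Cycles

variable [Fintype F]

/-- Type S1: the simple edges around the v-face of the 2-colex that comes from the face `f`. -/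
noncomputable def cycle1 (M : EmbGraph F) (f : M.Face) : Finset (ColEdge M.Qubit) :=
  (Finset.univ.filter fun x => M.faceOf x = f).biUnion fun x =>
    {M.greenEdge (x, .face), M.blueEdge x}

/-- Type S2: the simple edges and hyperedges on the boundary of the v-face that comes from the
vertex `v`, and every second (green) edge of its inner face. -/
noncomputable def cycle2 (M : EmbGraph F) (κ : F → Bool) (v : M.Vertex) :
    Finset (ColEdge M.Qubit) :=
  ((Finset.univ.filter fun x => M.vertexOf x = v).biUnion fun x =>
    {M.greenEdge (x, .vert), M.hyperEdge x}) ∪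
  (Finset.univ.filter fun x => M.vertexOf x = v ∧ κ x = true).image (M.innerEdge κ)

/-- Type S3: the loop of simple edges and hyperedges around the v-face of the face `f`, on the far
boundaries of the surrounding faces. On the e-face of a corner of `f` it uses the opposite green
edge, the two hyperedges there and the edge of the inner face between them; on the f-face
of an edge of `f`, it goes on from the hyperedges along the red edges and the blue edge on the side
of the other face at that edge. -/
noncomputable def cycle3 (M : EmbGraph F) (κ : F → Bool) (f : M.Face) :
    Finset (ColEdge M.Qubit) :=
  (Finset.univ.filter fun x => M.faceOf x = f).biUnion fun x =>
    {M.greenEdge (x, .vert), M.hyperEdge x, M.innerEdge κ x,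
      M.redEdge (M.τ2 x, .vert), M.blueEdge (M.τ2 x)}

/-- Type S4: the inner face at the vertex `v`. -/
noncomputable def cycle4 (M : EmbGraph F) (κ : F → Bool) (v : M.Vertex) :
    Finset (ColEdge M.Qubit) :=
  (Finset.univ.filter fun x => M.vertexOf x = v).image (M.innerEdge κ)

/-- Type S5: the e-face of the corner `c`. -/
noncomputable def cycle5 (M : EmbGraph F) (c : M.Corner) : Finset (ColEdge M.Qubit) :=
  (Finset.univ.filter fun x => M.cornerOf x = c).biUnion fun x =>
    {M.greenEdge (x, .vert), M.greenEdge (x, .face), M.redEdge (x, .vert)}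

/-- The pattern of qubits that carry the residual `Z` errors. The unit cell at a vertex `v` of `M`
consists of the v-face of `v`, its inner face and the e-faces next to it; the qubits `(x, face)` lie
on the outer boundary of the unit cell. The pattern `Ω`, a set of flags standing for such qubits,
has exactly one of the two outer qubits of every e-face and exactly one of the two qubits of every
blue edge that links e-faces of different unit cells. -/
def IsResidualPattern (M : EmbGraph F) (Ω : Finset F) : Prop :=
  (∀ x, x ∈ Ω ↔ M.τ1 x ∉ Ω) ∧ ∀ x, x ∈ Ω ↔ M.τ0 x ∉ Ω

/-- The `Z` error on the outer qubits given by the flags in `A`. -/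
noncomputable def residualError (M : EmbGraph F) (A : Finset F) : PauliOp M.Qubit :=
  zOn (A.image fun x => Sum.inl (x, Side.face))

/-- The projection to the surface code on the dual graph: `Z` on the edges under the qubits
of `A`. -/
noncomputable def projectedError (M : EmbGraph F) (A : Finset F) : PauliOp M.dual.Edge :=
  zOn (A.image M.dual.edgeOf)

/-- The qubits in `Ω` that lie over the edges in `D`. -/
noncomputable def lift (M : EmbGraph F) (Ω : Finset F) (D : Finset M.dual.Edge) : Finset F :=
  Ω.filter fun x => M.dual.edgeOf x ∈ D

end Cycles

end EmbGraph

/-! Errors matter only modulo the gauge group, so most of the argument runs in a quotient of the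
Pauli operators, a vector space over `ZMod 2`. There a link says that two single-qubit classes of
the same colour are equal, and green is the sum of red and blue because `Y = XZ` up to phase.

The hypergraph is properly coloured (`IsInnerColoring.isProper`). A hypercycle therefore meets a
qubit in no colour or in exactly two, and its operator acts there trivially or by the Pauli of the
third colour. So it commutes with all links (`IsHypercycle.syn_gauge`), and its syndromes can be
read off from the colours met. To be a stabilizer it only has to vanish in the quotient, where
nothing but its rank-3 edges contributes (`mkQ_cycleOp`).

Three relations carry the rest. The `Z` operators on an e-face multiply to a gauge operator
(`pauliClass_blue_square`). So do the `Z` operators at the promoted edges around a vertex of `M`,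
one per edge (`sum_blue_vert`), since the inner face trivializes the products of its `X` and of its
`Y` operators. Finally, an unpromoted blue edge identifies the `Z` operators at its ends.

S5 and S4 are products of `Z` over the components of the red-green graph, so trivial syndromes there
remove the `X` part of an error. S2 is `X` on a v-face and its inner face, and modulo outer `Z`
operators all `Z` classes there coincide; trivial S2 syndromes thus leave outer `Z` operators, which
blue edges move into `Ω`.

The outer qubit at a flag `x` is seen by S1 on the face of `x` and by S3 on the face across the
edge. Of the four flags of an edge, `τ0` switches membership in `Ω` and `τ2` switches the face
colour, so each colour selects one qubit of `Ω` over every edge (`IsResidualPattern.bijOn_edgeOf`).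
This gives the two surface codes. Corrections lift because a plaquette lifts to a gauge operator
(`IsResidualPattern.liftClass_plaquetteOp`), while vertex operators have no `Z` part. -/

/-! ### Cycle operators of properly coloured hypergraphs -/

section Hypergraph

variable {V : Type*}

/-- Any two edges of the same colour that share a vertex are equal. -/
def IsProper (H : Set (ColEdge V)) : Prop :=
  ∀ e ∈ H, ∀ e' ∈ H, ∀ v, v ∈ e.1 → v ∈ e'.1 → e.2 = e'.2 → e = e'

/-- Some edge of `σ` of colour `c` contains `v`. -/
def Meets (σ : Finset (ColEdge V)) (v : V) (c : EdgeColor) : Prop :=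
  ∃ e ∈ σ, v ∈ e.1 ∧ e.2 = c

/-- By properness at most one edge of each colour passes through a vertex, so counting incidences
reduces to asking which colours are met. -/
theorem sum_incident_color {H : Set (ColEdge V)} (hH : IsProper H) {σ : Finset (ColEdge V)}
    (hσ : ∀ e ∈ σ, e ∈ H) (v : V) (c : EdgeColor) (a : ZMod 2) :
    (∑ e ∈ σ, if v ∈ e.1 ∧ e.2 = c then a else 0) = if Meets σ v c then a else 0 := by
  split_ifs with h
  · obtain ⟨e, he, hv, hc⟩ := h
    rw [Finset.sum_eq_single_of_mem e he, if_pos ⟨hv, hc⟩]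
    intro e' he' hne
    rw [if_neg]
    rintro ⟨hv', hc'⟩
    exact hne (hH e' (hσ e' he') e (hσ e he) v hv' hv (hc'.trans hc.symm))
  · refine Finset.sum_eq_zero fun e he => if_neg fun h' => h ⟨e, he, h'⟩

theorem sum_incident {H : Set (ColEdge V)} (hH : IsProper H) {σ : Finset (ColEdge V)}
    (hσ : ∀ e ∈ σ, e ∈ H) (v : V) (φ : EdgeColor → ZMod 2) :
    (∑ e ∈ σ, if v ∈ e.1 then φ e.2 else 0) =
      (if Meets σ v .red then φ .red else 0) + (if Meets σ v .green then φ .green else 0) +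
        if Meets σ v .blue then φ .blue else 0 := by
  rw [← sum_incident_color hH hσ, ← sum_incident_color hH hσ, ← sum_incident_color hH hσ,
    ← Finset.sum_add_distrib, ← Finset.sum_add_distrib]
  refine Finset.sum_congr rfl fun e _ => ?_
  rcases e with ⟨s, _ | _ | _⟩ <;> simp

theorem edgeOp_fst (e : ColEdge V) (v : V) :
    (edgeOp e).1 v = if v ∈ e.1 then (if e.2 = .blue then 0 else 1) else 0 := by
  rcases e with ⟨s, _ | _ | _⟩ <;>
    simp [edgeOp, EdgeColor.pauli, Prod.fst_sum, Finset.sum_apply, Pi.single_apply]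

theorem edgeOp_snd (e : ColEdge V) (v : V) :
    (edgeOp e).2 v = if v ∈ e.1 then (if e.2 = .red then 0 else 1) else 0 := by
  rcases e with ⟨s, _ | _ | _⟩ <;>
    simp [edgeOp, EdgeColor.pauli, Prod.snd_sum, Finset.sum_apply, Pi.single_apply]

theorem isHypercycle_iff {H : Set (ColEdge V)} (hH : IsProper H) {σ : Finset (ColEdge V)}
    (hσ : ∀ e ∈ σ, e ∈ H) :
    IsHypercycle H σ ↔ ∀ v, ((if Meets σ v .red then 1 else 0) +
      (if Meets σ v .green then 1 else 0) + if Meets σ v .blue then 1 else 0 : ZMod 2) = 0 := by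
  have key : ∀ v, (((σ.filter fun e => v ∈ e.1).card : ℕ) : ZMod 2) =
      (if Meets σ v .red then 1 else 0) +
        (if Meets σ v .green then 1 else 0) + if Meets σ v .blue then 1 else 0 := by
    intro v
    rw [← sum_incident hH hσ v fun _ => 1, Finset.card_filter]
    push_cast
    rfl
  simp only [IsHypercycle, ← key, ZMod.natCast_eq_zero_iff_even]
  exact ⟨fun h => h.2, fun h => ⟨hσ, h⟩⟩

/-- Red and green contribute an `X`. The three colour indicators sum to zero, so red plus green can
be replaced by blue. -/
theorem IsHypercycle.cycleOp_fst {H : Set (ColEdge V)} (hH : IsProper H) {σ : Finset (ColEdge V)}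
    (hσ : IsHypercycle H σ) (v : V) :
    (cycleOp σ).1 v = if Meets σ v .blue then 1 else 0 := by
  have h := (isHypercycle_iff hH hσ.1).1 hσ v
  rw [cycleOp, Prod.fst_sum, Finset.sum_apply]
  simp only [edgeOp_fst]
  rw [sum_incident hH hσ.1 v fun c => if c = .blue then 0 else 1]
  simp only [reduceCtorEq, if_false, if_true, ite_self, add_zero]
  exact CharTwo.add_eq_zero.1 h

theorem IsHypercycle.cycleOp_snd {H : Set (ColEdge V)} (hH : IsProper H) {σ : Finset (ColEdge V)}
    (hσ : IsHypercycle H σ) (v : V) :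
    (cycleOp σ).2 v = if Meets σ v .red then 1 else 0 := by
  have h := (isHypercycle_iff hH hσ.1).1 hσ v
  rw [cycleOp, Prod.snd_sum, Finset.sum_apply]
  simp only [edgeOp_snd]
  rw [sum_incident hH hσ.1 v fun c => if c = .red then 0 else 1]
  simp only [reduceCtorEq, if_false, if_true, ite_self, zero_add]
  rw [add_assoc] at h
  exact (CharTwo.add_eq_zero.1 h).symm

/-! ### Syndromes of single-qubit errors and of gauge operators -/

variable [Fintype V]

theorem PauliOp.syn_add (P Q R : PauliOp V) : P.syn (Q + R) = P.syn Q + P.syn R := by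
  simp only [PauliOp.syn, ← Finset.sum_add_distrib]
  refine Finset.sum_congr rfl fun v _ => ?_
  simp only [Prod.snd_add, Prod.fst_add, Pi.add_apply]
  ring

theorem PauliOp.syn_zero (P : PauliOp V) : P.syn 0 = 0 := by simp [PauliOp.syn]

theorem PauliOp.syn_sum {ι : Type*} (P : PauliOp V) (s : Finset ι) (Q : ι → PauliOp V) :
    P.syn (∑ i ∈ s, Q i) = ∑ i ∈ s, P.syn (Q i) := by
  induction s using Finset.induction_on with
  | empty => simp [PauliOp.syn_zero]
  | insert a s ha ih => rw [Finset.sum_insert ha, Finset.sum_insert ha, PauliOp.syn_add, ih]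

theorem PauliOp.syn_red (P : PauliOp V) (v : V) : P.syn (EdgeColor.red.pauli v) = P.2 v := by
  simp [PauliOp.syn, EdgeColor.pauli, Pi.single_apply]

theorem PauliOp.syn_green (P : PauliOp V) (v : V) :
    P.syn (EdgeColor.green.pauli v) = P.1 v + P.2 v := by
  simp [PauliOp.syn, EdgeColor.pauli, Pi.single_apply, Finset.sum_add_distrib]

theorem PauliOp.syn_blue (P : PauliOp V) (v : V) : P.syn (EdgeColor.blue.pauli v) = P.1 v := by
  simp [PauliOp.syn, EdgeColor.pauli, Pi.single_apply]

theorem PauliOp.syn_zOn (P : PauliOp V) (A : Finset V) : P.syn (zOn A) = ∑ v ∈ A, P.1 v := by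
  rw [zOn, PauliOp.syn_sum]
  exact Finset.sum_congr rfl fun v _ => P.syn_blue v

/-- Where two colours are met, the operator is the Pauli of the missing colour, which anticommutes
with exactly the two others. -/
theorem IsHypercycle.syn_pauli {H : Set (ColEdge V)} (hH : IsProper H) {σ : Finset (ColEdge V)}
    (hσ : IsHypercycle H σ) (v : V) (c : EdgeColor) :
    (cycleOp σ).syn (c.pauli v) = if Meets σ v c then 1 else 0 := by
  have h := (isHypercycle_iff hH hσ.1).1 hσ v
  cases c
  · rw [PauliOp.syn_red, hσ.cycleOp_snd hH]
  · rw [PauliOp.syn_green, hσ.cycleOp_fst hH, hσ.cycleOp_snd hH]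
    refine CharTwo.add_eq_zero.1 ?_
    refine Eq.trans ?_ h
    ring
  · rw [PauliOp.syn_blue, hσ.cycleOp_fst hH]

/-- A link operator has one colour at both ends. By properness `σ` meets an end in that colour
exactly when the edge itself lies in `σ`, so the two signs agree and cancel. -/
theorem IsHypercycle.syn_gauge {H : Set (ColEdge V)} (hH : IsProper H) {σ : Finset (ColEdge V)}
    (hσ : IsHypercycle H σ) {g : PauliOp V} (hg : g ∈ gaugeGroup H) :
    (cycleOp σ).syn g = 0 := by
  have key : ∀ e ∈ H, ∀ u ∈ e.1, Meets σ u e.2 ↔ e ∈ σ := by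
    refine fun e he u hu => ⟨?_, fun h => ⟨e, h, hu, rfl⟩⟩
    rintro ⟨e', he', hu', hc⟩
    exact hH e he e' (hσ.1 e' he') u hu hu' hc.symm ▸ he'
  induction hg using AddSubgroup.closure_induction with
  | mem P hP =>
    obtain ⟨e, he, u, hu, w, hw, -, rfl⟩ := hP
    rw [PauliOp.syn_add, hσ.syn_pauli hH, hσ.syn_pauli hH]
    simp only [key e he u hu, key e he w hw]
    exact CharTwo.add_self_eq_zero _
  | zero => exact PauliOp.syn_zero _
  | add P Q _ _ hP hQ => rw [PauliOp.syn_add, hP, hQ, add_zero]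
  | neg P _ hP =>
    have h := PauliOp.syn_add (cycleOp σ) (-P) P
    rwa [neg_add_cancel, PauliOp.syn_zero, hP, add_zero, eq_comm] at h

end Hypergraph

/-! ### The cells of an embedded graph -/

namespace EmbGraph

variable {F : Type*} (M : EmbGraph F)

@[simp] theorem τ0_τ0 (x : F) : M.τ0 (M.τ0 x) = x := M.inv0 x
@[simp] theorem τ1_τ1 (x : F) : M.τ1 (M.τ1 x) = x := M.inv1 x
@[simp] theorem τ2_τ2 (x : F) : M.τ2 (M.τ2 x) = x := M.inv2 x

theorem eq_τ0_iff {x y : F} : x = M.τ0 y ↔ y = M.τ0 x :=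
  ⟨fun h => by simp [h], fun h => by simp [h]⟩
theorem eq_τ1_iff {x y : F} : x = M.τ1 y ↔ y = M.τ1 x :=
  ⟨fun h => by simp [h], fun h => by simp [h]⟩
theorem eq_τ2_iff {x y : F} : x = M.τ2 y ↔ y = M.τ2 x :=
  ⟨fun h => by simp [h], fun h => by simp [h]⟩

theorem τ2_eq_iff {x y : F} : M.τ2 x = y ↔ x = M.τ2 y := by rw [eq_comm, eq_τ2_iff]

@[simp] theorem dual_τ0 (x : F) : M.dual.τ0 x = M.τ2 x := rfl
@[simp] theorem dual_τ1 (x : F) : M.dual.τ1 x = M.τ1 x := rfl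
@[simp] theorem dual_τ2 (x : F) : M.dual.τ2 x = M.τ0 x := rfl

@[simp] theorem medialDual_τ0 (x : F) (s : Side) : M.medialDual.τ0 (x, s) = (x, s.swap) := rfl
@[simp] theorem medialDual_τ1_vert (x : F) : M.medialDual.τ1 (x, .vert) = (M.τ2 x, .vert) := rfl
@[simp] theorem medialDual_τ1_face (x : F) : M.medialDual.τ1 (x, .face) = (M.τ0 x, .face) := rfl
@[simp] theorem medialDual_τ2 (x : F) (s : Side) : M.medialDual.τ2 (x, s) = (M.τ1 x, s) := rfl
@[simp] theorem _root_.Side.swap_vert : Side.vert.swap = Side.face := rfl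
@[simp] theorem _root_.Side.swap_face : Side.face.swap = Side.vert := rfl

@[simp] theorem vertexOf_τ1 (x : F) : M.vertexOf (M.τ1 x) = M.vertexOf x :=
  Eq.symm (show M.vertexOf x = M.vertexOf (M.τ1 x) from Quot.sound (Or.inl rfl))
@[simp] theorem vertexOf_τ2 (x : F) : M.vertexOf (M.τ2 x) = M.vertexOf x :=
  Eq.symm (show M.vertexOf x = M.vertexOf (M.τ2 x) from Quot.sound (Or.inr rfl))
@[simp] theorem faceOf_τ1 (x : F) : M.faceOf (M.τ1 x) = M.faceOf x :=
  M.dual.vertexOf_τ1 x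
@[simp] theorem faceOf_τ0 (x : F) : M.faceOf (M.τ0 x) = M.faceOf x :=
  M.dual.vertexOf_τ2 x
@[simp] theorem edgeOf_τ0 (x : F) : M.edgeOf (M.τ0 x) = M.edgeOf x :=
  Eq.symm (show M.edgeOf x = M.edgeOf (M.τ0 x) from Quot.sound (Or.inl rfl))
@[simp] theorem edgeOf_τ2 (x : F) : M.edgeOf (M.τ2 x) = M.edgeOf x :=
  Eq.symm (show M.edgeOf x = M.edgeOf (M.τ2 x) from Quot.sound (Or.inr rfl))
@[simp] theorem cornerOf_τ1 (x : F) : M.cornerOf (M.τ1 x) = M.cornerOf x :=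
  Eq.symm (show M.cornerOf x = M.cornerOf (M.τ1 x) from Quot.sound rfl)
@[simp] theorem halfEdgeOf_τ2 (x : F) : M.halfEdgeOf (M.τ2 x) = M.halfEdgeOf x :=
  Eq.symm (show M.halfEdgeOf x = M.halfEdgeOf (M.τ2 x) from Quot.sound rfl)

theorem halfEdgeOf_eq_iff {x y : F} : M.halfEdgeOf x = M.halfEdgeOf y ↔ x = y ∨ x = M.τ2 y := by
  constructor
  · intro h
    -- The orbit of a flag is constant on classes and thus descends to the quotient, where it
    -- separates classes.
    let f : M.HalfEdge → Set F := Quot.lift (fun x => {x, M.τ2 x}) (by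
      rintro x _ rfl
      simp [Set.pair_comm])
    have h' : f (M.halfEdgeOf x) = f (M.halfEdgeOf y) := congrArg f h
    have hx : x ∈ f (M.halfEdgeOf x) := Or.inl rfl
    rw [h'] at hx
    exact hx
  · rintro (rfl | rfl) <;> simp

theorem edgeOf_eq_iff {x y : F} : M.edgeOf x = M.edgeOf y ↔
    x = y ∨ x = M.τ0 y ∨ x = M.τ2 y ∨ x = M.τ0 (M.τ2 y) := by
  constructor
  · intro h
    let f : M.Edge → Set F :=
      Quot.lift (fun x => {z | z = x ∨ z = M.τ0 x ∨ z = M.τ2 x ∨ z = M.τ0 (M.τ2 x)}) (by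
        rintro x _ (rfl | rfl)
        · ext z
          simp only [τ0_τ0, ← M.comm02, Set.mem_ofPred_eq]
          tauto
        · ext z
          simp only [τ2_τ2, Set.mem_ofPred_eq]
          tauto)
    have h' : f (M.edgeOf x) = f (M.edgeOf y) := congrArg f h
    have hx : x ∈ f (M.edgeOf x) := Or.inl rfl
    rw [h'] at hx
    exact hx
  · rintro (rfl | rfl | rfl | rfl) <;> simp

theorem dual_edgeOf_eq_iff {x y : F} : M.dual.edgeOf x = M.dual.edgeOf y ↔
    x = y ∨ x = M.τ0 y ∨ x = M.τ2 y ∨ x = M.τ0 (M.τ2 y) := by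
  rw [edgeOf_eq_iff, M.comm02]
  simp only [dual_τ0, dual_τ2]
  tauto

theorem halfEdgeOf_surjective : Function.Surjective M.halfEdgeOf := Quot.mk_surjective
theorem faceOf_surjective : Function.Surjective M.faceOf := Quot.mk_surjective
theorem edgeOf_surjective : Function.Surjective M.edgeOf := Quot.mk_surjective

/-- The vertex at which a half-edge starts. -/
def HalfEdge.vertex {M : EmbGraph F} (h : M.HalfEdge) : M.Vertex :=
  Quot.lift M.vertexOf (by rintro x _ rfl; simp) h

@[simp] theorem vertex_halfEdgeOf (x : F) : (M.halfEdgeOf x).vertex = M.vertexOf x := rfl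

theorem forall_qubit {p : M.Qubit → Prop} : (∀ q, p q) ↔
    (∀ x, p (.inl (x, .vert))) ∧ (∀ x, p (.inl (x, .face))) ∧ ∀ x, p (.inr (M.halfEdgeOf x)) := by
  refine ⟨fun h => ⟨fun _ => h _, fun _ => h _, fun _ => h _⟩, ?_⟩
  rintro ⟨h1, h2, h3⟩ (⟨x, _ | _⟩ | h)
  · exact h1 x
  · exact h2 x
  · obtain ⟨x, rfl⟩ := M.halfEdgeOf_surjective h
    exact h3 x

/-! ### The generalized five-squares hypergraph is properly coloured -/

variable {M} {κ : F → Bool}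

/-- The colouring is fixed by `τ1` and flipped by `τ2`. This excludes vertices with a single
half-edge, so inner edges are never loops. -/
theorem IsInnerColoring.τ1_ne_τ2 (hκ : M.IsInnerColoring κ) (x : F) : M.τ1 x ≠ M.τ2 x := by
  intro h
  have h1 := hκ.1 x
  rw [h, hκ.2 x] at h1
  simp at h1

theorem IsInnerColoring.halfEdgeOf_ne (hκ : M.IsInnerColoring κ) (x : F) :
    M.halfEdgeOf x ≠ M.halfEdgeOf (M.τ1 x) := by
  rw [Ne, M.halfEdgeOf_eq_iff]
  rintro (h | h)
  · exact M.ne1 x h.symm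
  · exact hκ.τ1_ne_τ2 x (M.eq_τ2_iff.1 h)

theorem redEdge_swap (x : F) (s : Side) : M.redEdge (x, s.swap) = M.redEdge (x, s) := by
  cases s <;> simp [redEdge, Finset.pair_comm]

theorem greenEdge_τ1 (x : F) (s : Side) : M.greenEdge (M.τ1 x, s) = M.greenEdge (x, s) := by
  simp [greenEdge, Finset.pair_comm]

theorem blueEdge_τ0 (x : F) : M.blueEdge (M.τ0 x) = M.blueEdge x := by
  simp [blueEdge, Finset.pair_comm]

theorem hyperEdge_τ2 (x : F) : M.hyperEdge (M.τ2 x) = M.hyperEdge x := by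
  simp [hyperEdge, Finset.insert_comm]

theorem IsInnerColoring.innerEdge_τ1 (hκ : M.IsInnerColoring κ) (x : F) :
    M.innerEdge κ (M.τ1 x) = M.innerEdge κ x := by
  simp [innerEdge, Finset.pair_comm, hκ.1]

theorem forall_fiveSquares {p : ColEdge M.Qubit → Prop} :
    (∀ e ∈ M.fiveSquares κ, p e) ↔ (∀ x, p (M.redEdge (x, .vert))) ∧
      (∀ x s, p (M.greenEdge (x, s))) ∧ (∀ x, p (M.blueEdge x)) ∧ (∀ x, p (M.hyperEdge x)) ∧
      ∀ x, p (M.innerEdge κ x) := by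
  have hred : (∀ x s, p (M.redEdge (x, s))) ↔ ∀ x, p (M.redEdge (x, .vert)) := by
    refine ⟨fun h x => h x _, fun h x s => ?_⟩
    cases s
    · exact h x
    · exact redEdge_swap (M := M) x .vert ▸ h x
  simp only [fiveSquares, Set.mem_union, or_imp, forall_and, Set.forall_mem_range, Prod.forall,
    hred, and_assoc]

theorem redEdge_mem (p : F × Side) : M.redEdge p ∈ M.fiveSquares κ := by simp [fiveSquares]
theorem greenEdge_mem (p : F × Side) : M.greenEdge p ∈ M.fiveSquares κ := by simp [fiveSquares]
theorem blueEdge_mem (x : F) : M.blueEdge x ∈ M.fiveSquares κ := by simp [fiveSquares]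
theorem hyperEdge_mem (x : F) : M.hyperEdge x ∈ M.fiveSquares κ := by simp [fiveSquares]
theorem innerEdge_mem (x : F) : M.innerEdge κ x ∈ M.fiveSquares κ := by simp [fiveSquares]

/-- The only conflict could arise at an inner qubit, which lies on two inner edges; their colours
differ because `κ` alternates under `τ2`. -/
theorem IsInnerColoring.isProper (hκ : M.IsInnerColoring κ) : IsProper (M.fiveSquares κ) := by
  -- the edge of a given colour at a given qubit is a function of the two
  have hv : ∀ e ∈ M.fiveSquares κ, ∀ x, Sum.inl (x, .vert) ∈ e.1 →
      e = M.redEdge (x, .vert) ∨ e = M.greenEdge (x, .vert) ∨ e = M.hyperEdge x := by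
    rw [forall_fiveSquares]
    refine ⟨?_, ?_, ?_, ?_, ?_⟩
    · intro y x h
      have : x = y := by simpa [redEdge] using h
      simp [this]
    · rintro y (_ | _) x h
      · have : x = y ∨ x = M.τ1 y := by simpa [greenEdge] using h
        rcases this with rfl | rfl <;> simp [greenEdge_τ1]
      · simp [greenEdge] at h
    · intro y x h
      simp [blueEdge] at h
    · intro y x h
      have : x = y ∨ x = M.τ2 y := by simpa [hyperEdge] using h
      rcases this with rfl | rfl <;> simp [hyperEdge_τ2]
    · intro y x h
      simp [innerEdge] at h
  have hf : ∀ e ∈ M.fiveSquares κ, ∀ x, Sum.inl (x, .face) ∈ e.1 →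
      e = M.redEdge (x, .vert) ∨ e = M.greenEdge (x, .face) ∨ e = M.blueEdge x := by
    rw [forall_fiveSquares]
    refine ⟨?_, ?_, ?_, ?_, ?_⟩
    · intro y x h
      have : x = y := by simpa [redEdge] using h
      simp [this]
    · rintro y (_ | _) x h
      · simp [greenEdge] at h
      · have : x = y ∨ x = M.τ1 y := by simpa [greenEdge] using h
        rcases this with rfl | rfl <;> simp [greenEdge_τ1]
    · intro y x h
      have : x = y ∨ x = M.τ0 y := by simpa [blueEdge] using h
      rcases this with rfl | rfl <;> simp [blueEdge_τ0]
    · intro y x h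
      simp [hyperEdge] at h
    · intro y x h
      simp [innerEdge] at h
  have hh : ∀ e ∈ M.fiveSquares κ, ∀ x, Sum.inr (M.halfEdgeOf x) ∈ e.1 →
      e = M.hyperEdge x ∨ e = M.innerEdge κ x ∨ e = M.innerEdge κ (M.τ2 x) := by
    rw [forall_fiveSquares]
    refine ⟨?_, ?_, ?_, ?_, ?_⟩
    · intro y x h
      simp [redEdge] at h
    · rintro y (_ | _) x h <;> simp [greenEdge] at h
    · intro y x h
      simp [blueEdge] at h
    · intro y x h
      have : x = y ∨ x = M.τ2 y := by simpa [hyperEdge, halfEdgeOf_eq_iff] using h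
      rcases this with rfl | rfl <;> simp [hyperEdge_τ2]
    · intro y x h
      have : (x = y ∨ x = M.τ2 y) ∨ x = M.τ1 y ∨ x = M.τ2 (M.τ1 y) := by
        simpa [innerEdge, halfEdgeOf_eq_iff] using h
      rcases this with (rfl | rfl) | rfl | rfl <;> simp [hκ.innerEdge_τ1]
  intro e he e' he' q
  revert q
  rw [forall_qubit]
  refine ⟨?_, ?_, ?_⟩
  · intro x h h' hc
    rcases hv e he x h with rfl | rfl | rfl <;> rcases hv e' he' x h' with rfl | rfl | rfl <;>
      first | rfl | simp [redEdge, greenEdge, hyperEdge] at hc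
  · intro x h h' hc
    rcases hf e he x h with rfl | rfl | rfl <;> rcases hf e' he' x h' with rfl | rfl | rfl <;>
      first | rfl | simp [redEdge, greenEdge, blueEdge] at hc
  · intro x h h' hc
    rcases hh e he x h with rfl | rfl | rfl <;> rcases hh e' he' x h' with rfl | rfl | rfl <;>
      first | rfl | (cases hx : κ x <;> simp [hyperEdge, innerEdge, hκ.2, hx] at hc)

end EmbGraph

/-! ### Colours met by unions and images of edge sets -/

section Meets

variable {V : Type*} {q : V} {c : EdgeColor}

theorem meets_singleton {e : ColEdge V} : Meets {e} q c ↔ q ∈ e.1 ∧ e.2 = c := by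
  simp [Meets]

variable [DecidableEq (ColEdge V)]

theorem meets_insert {e : ColEdge V} {σ : Finset (ColEdge V)} :
    Meets (insert e σ) q c ↔ (q ∈ e.1 ∧ e.2 = c) ∨ Meets σ q c := by
  simp [Meets]

theorem meets_union {σ τ : Finset (ColEdge V)} :
    Meets (σ ∪ τ) q c ↔ Meets σ q c ∨ Meets τ q c := by
  simp [Meets, or_and_right, exists_or]

theorem meets_biUnion {ι : Type*} {s : Finset ι} {t : ι → Finset (ColEdge V)} :
    Meets (s.biUnion t) q c ↔ ∃ i ∈ s, Meets (t i) q c := by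
  simp only [Meets, Finset.mem_biUnion]
  tauto

theorem meets_image {ι : Type*} {s : Finset ι} {t : ι → ColEdge V} :
    Meets (s.image t) q c ↔ ∃ i ∈ s, q ∈ (t i).1 ∧ (t i).2 = c := by
  simp [Meets]

end Meets

namespace EmbGraph

variable {F : Type*} {M : EmbGraph F} {κ : F → Bool}

/-! ### Incidence of qubits and edges -/

section Incidence

variable {x y : F} {s s' : Side}

theorem inl_mem_redEdge : Sum.inl (x, s) ∈ (M.redEdge (y, s')).1 ↔ y = x := by
  cases s <;> cases s' <;> simp [redEdge, eq_comm]

theorem inr_notMem_redEdge {h : M.HalfEdge} {p : F × Side} : Sum.inr h ∉ (M.redEdge p).1 := by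
  simp [redEdge]

theorem inl_mem_greenEdge :
    Sum.inl (x, s) ∈ (M.greenEdge (y, s')).1 ↔ s' = s ∧ (y = x ∨ y = M.τ1 x) := by
  cases s <;> cases s' <;> simp [greenEdge, M.eq_τ1_iff (x := x), eq_comm (a := y) (b := x)]

theorem inr_notMem_greenEdge {h : M.HalfEdge} {p : F × Side} :
    Sum.inr h ∉ (M.greenEdge p).1 := by
  simp [greenEdge]

theorem inl_mem_blueEdge :
    Sum.inl (x, s) ∈ (M.blueEdge y).1 ↔ s = .face ∧ (y = x ∨ y = M.τ0 x) := by
  cases s <;> simp [blueEdge, M.eq_τ0_iff (x := x), eq_comm (a := y) (b := x)]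

theorem inr_notMem_blueEdge {h : M.HalfEdge} : Sum.inr h ∉ (M.blueEdge y).1 := by
  simp [blueEdge]

theorem inl_mem_hyperEdge :
    Sum.inl (x, s) ∈ (M.hyperEdge y).1 ↔ s = .vert ∧ (y = x ∨ y = M.τ2 x) := by
  cases s <;> simp [hyperEdge, M.eq_τ2_iff (x := x), eq_comm (a := y) (b := x)]

theorem inr_mem_hyperEdge :
    Sum.inr (M.halfEdgeOf x) ∈ (M.hyperEdge y).1 ↔ y = x ∨ y = M.τ2 x := by
  simp [hyperEdge, halfEdgeOf_eq_iff, M.eq_τ2_iff (x := x), eq_comm (a := y) (b := x)]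

theorem inl_notMem_innerEdge {p : F × Side} : Sum.inl p ∉ (M.innerEdge κ y).1 := by
  simp [innerEdge]

theorem inr_mem_innerEdge : Sum.inr (M.halfEdgeOf x) ∈ (M.innerEdge κ y).1 ↔
    y = x ∨ y = M.τ2 x ∨ y = M.τ1 x ∨ y = M.τ1 (M.τ2 x) := by
  simp only [innerEdge, Finset.mem_insert, Finset.mem_singleton, Sum.inr.injEq,
    halfEdgeOf_eq_iff]
  rw [M.eq_τ1_iff (x := x), M.eq_τ2_iff (x := x), M.eq_τ2_iff (x := x) (y := M.τ1 y),
    eq_comm (a := M.τ1 y), M.eq_τ1_iff (x := M.τ2 x), or_assoc, eq_comm (a := y) (b := x)]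

end Incidence

/-! ### The qubits on the edges of each colour of the five types of cycles -/

/-- A colouring of the flags that comes from a colouring of the faces for which the two sides of
every edge differ. -/
structure IsFaceColoring (M : EmbGraph F) (c : F → Bool) : Prop where
  τ0 : ∀ x, c (M.τ0 x) = c x
  τ1 : ∀ x, c (M.τ1 x) = c x
  τ2 : ∀ x, c (M.τ2 x) = !c x

theorem Bicolorable.exists_coloring (hM : M.Bicolorable) :
    ∃ c : M.Face → Bool, M.IsFaceColoring fun x => c (M.faceOf x) := by
  obtain ⟨c, hc⟩ := hM
  refine ⟨c, fun x => by simp, fun x => by simp, fun x => ?_⟩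
  have := hc x
  revert this
  cases c (M.faceOf x) <;> cases c (M.faceOf (M.τ2 x)) <;> simp

theorem Bicolorable.faceOf_ne (hM : M.Bicolorable) (x : F) :
    M.faceOf x ≠ M.faceOf (M.τ2 x) := by
  obtain ⟨c, hc⟩ := hM
  exact fun h => hc x (congrArg c h)

variable [Fintype F]

section Meets

variable {c : EdgeColor} {x : F}

theorem meets_cycle1_vert {f : M.Face} : ¬ Meets (M.cycle1 f) (.inl (x, .vert)) c := by
  simp [cycle1, meets_biUnion, meets_insert, meets_singleton, inl_mem_greenEdge, inl_mem_blueEdge]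

theorem meets_cycle1_face {f : M.Face} :
    Meets (M.cycle1 f) (.inl (x, .face)) c ↔ M.faceOf x = f ∧ c ≠ .red := by
  simp only [cycle1, meets_biUnion, meets_insert, meets_singleton, inl_mem_greenEdge,
    inl_mem_blueEdge]
  cases c <;> simp [greenEdge, blueEdge, and_or_left, exists_or]

theorem meets_cycle1_inner {f : M.Face} {h : M.HalfEdge} :
    ¬ Meets (M.cycle1 f) (.inr h) c := by
  simp [cycle1, meets_biUnion, meets_insert, meets_singleton, inr_notMem_greenEdge,
    inr_notMem_blueEdge]

theorem meets_cycle2_vert {v : M.Vertex} :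
    Meets (M.cycle2 κ v) (.inl (x, .vert)) c ↔ M.vertexOf x = v ∧ c ≠ .red := by
  simp only [cycle2, meets_biUnion, meets_insert, meets_singleton, inl_mem_greenEdge,
    inl_mem_hyperEdge, meets_union, meets_image, inl_notMem_innerEdge]
  cases c <;> simp [greenEdge, hyperEdge, and_or_left, exists_or]

theorem meets_cycle2_face {v : M.Vertex} : ¬ Meets (M.cycle2 κ v) (.inl (x, .face)) c := by
  simp [cycle2, meets_biUnion, meets_insert, meets_singleton, inl_mem_greenEdge,
    inl_mem_hyperEdge, meets_union, meets_image, inl_notMem_innerEdge]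

theorem meets_cycle2_inner (hκ : M.IsInnerColoring κ) {v : M.Vertex} :
    Meets (M.cycle2 κ v) (.inr (M.halfEdgeOf x)) c ↔ M.vertexOf x = v ∧ c ≠ .red := by
  simp only [cycle2, meets_biUnion, meets_insert, meets_singleton, inr_notMem_greenEdge,
    inr_mem_hyperEdge, meets_union, meets_image, inr_mem_innerEdge]
  cases c <;> cases h : κ x <;>
    simp [greenEdge, hyperEdge, innerEdge, and_or_left, or_and_right, exists_or, hκ.1, hκ.2, h]

/-- The loop reaches such a qubit from two sides: along the green edge opposite to `f` when `f` is
the face of `x`, along a red edge when `f` lies across the edge. The rank-3 edge belongs to both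
cases. -/
theorem meets_cycle3_vert {f : M.Face} :
    Meets (M.cycle3 κ f) (.inl (x, .vert)) c ↔
      M.faceOf x = f ∧ c ≠ .red ∨ M.faceOf (M.τ2 x) = f ∧ c ≠ .green := by
  simp only [cycle3, meets_biUnion, meets_insert, meets_singleton, inl_mem_greenEdge,
    inl_mem_hyperEdge, inl_notMem_innerEdge, inl_mem_redEdge, inl_mem_blueEdge]
  cases c <;>
    simp [greenEdge, hyperEdge, redEdge, blueEdge, and_or_left, exists_or, τ2_eq_iff]

theorem meets_cycle3_face {f : M.Face} :
    Meets (M.cycle3 κ f) (.inl (x, .face)) c ↔ M.faceOf (M.τ2 x) = f ∧ c ≠ .green := by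
  simp only [cycle3, meets_biUnion, meets_insert, meets_singleton, inl_mem_greenEdge,
    inl_mem_hyperEdge, inl_notMem_innerEdge, inl_mem_redEdge, inl_mem_blueEdge]
  cases c <;>
    simp [greenEdge, hyperEdge, redEdge, blueEdge, and_or_left, exists_or, τ2_eq_iff, ← M.comm02]

theorem meets_cycle3_inner (hκ : M.IsInnerColoring κ) {f : M.Face} :
    Meets (M.cycle3 κ f) (.inr (M.halfEdgeOf x)) c ↔
      M.faceOf x = f ∧ c ≠ (if κ x then .red else .green) ∨
      M.faceOf (M.τ2 x) = f ∧ c ≠ (if κ x then .green else .red) := by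
  simp only [cycle3, meets_biUnion, meets_insert, meets_singleton, inr_notMem_greenEdge,
    inr_mem_hyperEdge, inr_mem_innerEdge, inr_notMem_redEdge, inr_notMem_blueEdge]
  cases c <;> cases h : κ x <;>
    simp [greenEdge, hyperEdge, innerEdge, and_or_left, or_and_right, exists_or, hκ.1, hκ.2, h]

theorem meets_cycle4_outer {v : M.Vertex} {p : F × Side} :
    ¬ Meets (M.cycle4 κ v) (.inl p) c := by
  simp [cycle4, meets_image, inl_notMem_innerEdge]

theorem meets_cycle4_inner (hκ : M.IsInnerColoring κ) {v : M.Vertex} :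
    Meets (M.cycle4 κ v) (.inr (M.halfEdgeOf x)) c ↔ M.vertexOf x = v ∧ c ≠ .blue := by
  simp only [cycle4, meets_image, inr_mem_innerEdge]
  cases c <;> cases h : κ x <;>
    simp [innerEdge, and_or_left, or_and_right, exists_or, hκ.1, hκ.2, h]

theorem meets_cycle5_outer {d : M.Corner} {s : Side} :
    Meets (M.cycle5 d) (.inl (x, s)) c ↔ M.cornerOf x = d ∧ c ≠ .blue := by
  simp only [cycle5, meets_biUnion, meets_insert, meets_singleton, inl_mem_greenEdge,
    inl_mem_redEdge]
  cases c <;> cases s <;> simp [greenEdge, redEdge, and_or_left, exists_or]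

theorem meets_cycle5_inner {d : M.Corner} {h : M.HalfEdge} : ¬ Meets (M.cycle5 d) (.inr h) c := by
  simp [cycle5, meets_biUnion, meets_insert, meets_singleton, inr_notMem_greenEdge,
    inr_notMem_redEdge]

end Meets
end EmbGraph

/-! ### Pauli operators modulo gauge operators -/

section Quotient

variable {V : Type*}

/-- The class modulo `S` of the single-qubit operator of colour `c` at `v`. -/
noncomputable def pauliClass (S : Submodule (ZMod 2) (PauliOp V)) (c : EdgeColor) (v : V) :
    PauliOp V ⧸ S :=
  S.mkQ (c.pauli v)

variable {S : Submodule (ZMod 2) (PauliOp V)} {H : Set (ColEdge V)}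

theorem pauliClass_green (v : V) :
    pauliClass S .green v = pauliClass S .red v + pauliClass S .blue v := by
  rw [pauliClass, pauliClass, pauliClass, ← map_add]
  simp [EdgeColor.pauli]

/-- The difference of the two classes is a link operator. `S` is any subspace containing the gauge
group, since the relations are also needed after adjoining certain `Z` operators to it. -/
theorem pauliClass_eq_of_mem (hS : ∀ P ∈ gaugeGroup H, P ∈ S) {e : ColEdge V} (he : e ∈ H)
    {u w : V} (hu : u ∈ e.1) (hw : w ∈ e.1) : pauliClass S e.2 u = pauliClass S e.2 w := by
  by_cases h : u = w
  · rw [h]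
  · refine (Submodule.Quotient.eq S).2 (hS _ (AddSubgroup.subset_closure ?_))
    exact ⟨e, he, u, hu, w, hw, h, ZModModule.sub_eq_add _ _⟩

theorem mkQ_edgeOp (e : ColEdge V) : S.mkQ (edgeOp e) = ∑ v ∈ e.1, pauliClass S e.2 v := by
  rw [edgeOp, map_sum]
  rfl

theorem mkQ_edgeOp_eq_zero (hS : ∀ P ∈ gaugeGroup H, P ∈ S) {e : ColEdge V} (he : e ∈ H)
    (hcard : e.1.card = 2) : S.mkQ (edgeOp e) = 0 := by
  obtain ⟨u, w, huw, h⟩ := Finset.card_eq_two.1 hcard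
  rw [mkQ_edgeOp, h, Finset.sum_pair huw,
    pauliClass_eq_of_mem hS he (u := u) (w := w) (by simp [h]) (by simp [h])]
  exact ZModModule.add_self _

/-- Three equal classes add up to one of them in characteristic 2. This is why rank-3 edges, unlike
rank-2 edges, survive in the quotient. -/
theorem mkQ_edgeOp_of_card_eq_three (hS : ∀ P ∈ gaugeGroup H, P ∈ S) {e : ColEdge V} (he : e ∈ H)
    (hcard : e.1.card = 3) {u : V} (hu : u ∈ e.1) :
    S.mkQ (edgeOp e) = pauliClass S e.2 u := by
  rw [mkQ_edgeOp, Finset.sum_congr rfl fun v hv => pauliClass_eq_of_mem hS he hv hu,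
    Finset.sum_const, hcard, succ_nsmul, two_nsmul, ZModModule.add_self, zero_add]

theorem mkQ_zOn (A : Finset V) : S.mkQ (zOn A) = ∑ v ∈ A, pauliClass S .blue v := by
  rw [zOn, map_sum]
  rfl

theorem mkQ_eq_sum [Fintype V] (P : PauliOp V) :
    S.mkQ P = ∑ v, P.1 v • pauliClass S .red v + ∑ v, P.2 v • pauliClass S .blue v := by
  simp only [pauliClass, ← map_smul, ← map_sum, ← map_add]
  congr 1
  ext v <;> simp [EdgeColor.pauli, Prod.fst_sum, Prod.snd_sum, Finset.sum_apply, Pi.single_apply]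

/-- A weighted sum of values that depend only on the class of the index vanishes if for every class
the value or the total weight does. -/
theorem sum_smul_eq_zero_of_fiber {ι κ R A : Type*} [Fintype ι] [DecidableEq κ] [Semiring R]
    [AddCommMonoid A] [Module R A] (π : ι → κ) (w : ι → R) (g : κ → A)
    (h : ∀ k, g k = 0 ∨ ∑ i, (if π i = k then w i else 0) = 0) : ∑ i, w i • g (π i) = 0 := by
  rw [← Finset.sum_fiberwise_of_maps_to (t := Finset.univ.image π) (g := π) (by simp)]
  refine Finset.sum_eq_zero fun k _ => ?_
  rw [Finset.sum_congr rfl fun i hi => by rw [(Finset.mem_filter.1 hi).2], ← Finset.sum_smul,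
    Finset.sum_filter]
  rcases h k with h | h <;> rw [h]
  · exact smul_zero _
  · exact zero_smul _ _

end Quotient

namespace EmbGraph

variable {F : Type*} {M : EmbGraph F} {κ : F → Bool}

/-! ### Relations between the classes of single-qubit operators -/

section Relations

variable {S : Submodule (ZMod 2) (PauliOp M.Qubit)}

theorem pauliClass_red_vert (hS : ∀ P ∈ gaugeGroup (M.fiveSquares κ), P ∈ S) (x : F) :
    pauliClass S .red (.inl (x, .vert)) = pauliClass S .red (.inl (x, .face)) :=
  pauliClass_eq_of_mem hS (redEdge_mem (x, .vert)) (inl_mem_redEdge.2 rfl) (inl_mem_redEdge.2 rfl)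

theorem pauliClass_green_τ1 (hS : ∀ P ∈ gaugeGroup (M.fiveSquares κ), P ∈ S) (x : F) (s : Side) :
    pauliClass S .green (.inl (M.τ1 x, s)) = pauliClass S .green (.inl (x, s)) :=
  pauliClass_eq_of_mem hS (greenEdge_mem (x, s)) (inl_mem_greenEdge.2 (by simp))
    (inl_mem_greenEdge.2 (by simp))

theorem pauliClass_blue_τ0 (hS : ∀ P ∈ gaugeGroup (M.fiveSquares κ), P ∈ S) (x : F) :
    pauliClass S .blue (.inl (M.τ0 x, .face)) = pauliClass S .blue (.inl (x, .face)) :=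
  pauliClass_eq_of_mem hS (blueEdge_mem x) (inl_mem_blueEdge.2 (by simp))
    (inl_mem_blueEdge.2 (by simp))

theorem pauliClass_blue_vert (hS : ∀ P ∈ gaugeGroup (M.fiveSquares κ), P ∈ S) (x : F) :
    pauliClass S .blue (.inl (x, .vert)) = pauliClass S .blue (.inr (M.halfEdgeOf x)) :=
  pauliClass_eq_of_mem hS (hyperEdge_mem x) (inl_mem_hyperEdge.2 (by simp))
    (inr_mem_hyperEdge.2 (by simp))

theorem pauliClass_inner (hS : ∀ P ∈ gaugeGroup (M.fiveSquares κ), P ∈ S) (x : F) :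
    pauliClass S (if κ x then .green else .red) (.inr (M.halfEdgeOf (M.τ1 x))) =
      pauliClass S (if κ x then .green else .red) (.inr (M.halfEdgeOf x)) :=
  pauliClass_eq_of_mem hS (innerEdge_mem x) (inr_mem_innerEdge.2 (by simp))
    (inr_mem_innerEdge.2 (by simp))

/-- The product of the `Z` operators on the four qubits of an e-face is a gauge operator. -/
theorem pauliClass_blue_square (hS : ∀ P ∈ gaugeGroup (M.fiveSquares κ), P ∈ S) (x : F) :
    pauliClass S .blue (.inl (x, .vert)) + pauliClass S .blue (.inl (x, .face)) +
      (pauliClass S .blue (.inl (M.τ1 x, .vert)) + pauliClass S .blue (.inl (M.τ1 x, .face))) =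
        0 := by
  -- The ends of a red edge have the same red class, so on such a pair blue may be traded for green,
  -- and green is preserved by `τ1`.
  have key : ∀ y, pauliClass S .blue (.inl (y, .vert)) + pauliClass S .blue (.inl (y, .face)) =
      pauliClass S .green (.inl (y, .vert)) + pauliClass S .green (.inl (y, .face)) := by
    intro y
    rw [pauliClass_green, pauliClass_green, pauliClass_red_vert hS, add_add_add_comm,
      ZModModule.add_self, zero_add]
  rw [key, key, pauliClass_green_τ1 hS, pauliClass_green_τ1 hS, ZModModule.add_self]

variable [Fintype F]

/-- A sum over half-edges at a vertex does not depend on how each of them is represented by one of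
its two flags. -/
theorem sum_halfEdge_congr {A : Type*} [AddCommMonoid A] {d d' : F → Bool}
    (hd : ∀ x, d (M.τ2 x) = !d x) (hd' : ∀ x, d' (M.τ2 x) = !d' x) (v : M.Vertex)
    (g : M.HalfEdge → A) :
    ∑ x with M.vertexOf x = v ∧ d x = true, g (M.halfEdgeOf x) =
      ∑ x with M.vertexOf x = v ∧ d' x = true, g (M.halfEdgeOf x) := by
  refine Finset.sum_nbij' (fun x => if d' x then x else M.τ2 x)
    (fun x => if d x then x else M.τ2 x) ?_ ?_ ?_ ?_ ?_
  all_goals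
    intro x hx
    simp only [Finset.mem_filter, Finset.mem_univ, true_and] at hx ⊢
    obtain ⟨hx1, hx2⟩ := hx
  · cases h : d' x <;> simp [h, hx1, hd']
  · cases h : d x <;> simp [h, hx1, hd]
  · cases h : d' x <;> simp [hx2, hd]
  · cases h : d x <;> simp [hx2, hd']
  · cases h : d' x <;> simp

/-- The green inner edges pair up all qubits of the inner face, so the product of their `Y`
operators is gauge; the red ones do the same for `X`. Hence the product of the `Z` operators is
gauge too. The function `d` merely selects one flag per half-edge. -/
theorem sum_blue_inner (hS : ∀ P ∈ gaugeGroup (M.fiveSquares κ), P ∈ S)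
    (hκ : M.IsInnerColoring κ) {d : F → Bool} (hd : ∀ x, d (M.τ2 x) = !d x) (v : M.Vertex) :
    ∑ x with M.vertexOf x = v ∧ d x = true, pauliClass S .blue (.inr (M.halfEdgeOf x)) = 0 := by
  rw [sum_halfEdge_congr hd hκ.2 v fun h => pauliClass S .blue (.inr h)]
  have hinv : ∀ (b : Bool) (c : EdgeColor), (∀ x, κ x = b → (if κ x then .green else .red) = c) →
      ∑ x with M.vertexOf x = v ∧ κ x = b, pauliClass S c (.inr (M.halfEdgeOf x)) = 0 := by
    intro b c hc
    refine Finset.sum_involution (fun x _ => M.τ1 x) ?_ (fun x _ _ => M.ne1 x) ?_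
      fun x _ => M.inv1 x
    · intro x hx
      have := pauliClass_inner hS x
      rw [hc x (Finset.mem_filter.1 hx).2.2] at this
      rw [this, ZModModule.add_self]
    · intro x hx
      simpa [hκ.1] using hx
  have hg := hinv true .green (by simp +contextual)
  have hr := hinv false .red (by simp +contextual)
  -- The red relation is indexed by the flags with `κ` false. These represent the same half-edges,
  -- so it can be re-indexed to match the green one.
  have hr' : ∑ x with M.vertexOf x = v ∧ κ x = true,
      pauliClass S .red (.inr (M.halfEdgeOf x)) = 0 := by
    rw [← hr, ← sum_halfEdge_congr (d := fun x => !κ x) (by simp [hκ.2]) hκ.2 v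
      fun h => pauliClass S .red (.inr h)]
    simp
  simpa only [pauliClass_green, Finset.sum_add_distrib, hr', zero_add] using hg

theorem sum_blue_vert (hS : ∀ P ∈ gaugeGroup (M.fiveSquares κ), P ∈ S)
    (hκ : M.IsInnerColoring κ) {d : F → Bool} (hd : ∀ x, d (M.τ2 x) = !d x) (v : M.Vertex) :
    ∑ x with M.vertexOf x = v ∧ d x = true, pauliClass S .blue (.inl (x, .vert)) = 0 := by
  rw [← sum_blue_inner hS hκ hd v]
  exact Finset.sum_congr rfl fun x _ => pauliClass_blue_vert hS x

/-- Over a set of corners, the `Z` operators on the two sides of the e-faces agree. -/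
theorem sum_blue_vert_eq_face (hS : ∀ P ∈ gaugeGroup (M.fiveSquares κ), P ∈ S)
    {p : F → Prop} [DecidablePred p] (hp : ∀ x, p (M.τ1 x) ↔ p x) :
    ∑ x with p x, pauliClass S .blue (.inl (x, .vert)) =
      ∑ x with p x, pauliClass S .blue (.inl (x, .face)) := by
  rw [← sub_eq_zero, ZModModule.sub_eq_add, ← Finset.sum_add_distrib]
  refine Finset.sum_involution (fun x _ => M.τ1 x) (fun x _ => pauliClass_blue_square hS x)
    (fun x _ _ => M.ne1 x) ?_ fun x _ => M.inv1 x
  intro x hx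
  simpa [hp] using hx

theorem sum_blue_face (hS : ∀ P ∈ gaugeGroup (M.fiveSquares κ), P ∈ S)
    {p : F → Prop} [DecidablePred p] (hp : ∀ x, p (M.τ0 x) ↔ p x) :
    ∑ x with p x, pauliClass S .blue (.inl (x, .face)) = 0 := by
  refine Finset.sum_involution (fun x _ => M.τ0 x) ?_
    (fun x _ _ => M.ne0 x) ?_ fun x _ => M.inv0 x
  · intro x _
    rw [pauliClass_blue_τ0 hS, ZModModule.add_self]
  · intro x hx
    simpa [hp] using hx

end Relations

/-! ### The cycles are hypercycles and their operators are stabilizers -/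

theorem card_redEdge (x : F) (s : Side) : (M.redEdge (x, s)).1.card = 2 := by
  rw [redEdge, Finset.card_pair]
  cases s <;> simp

theorem card_greenEdge (x : F) (s : Side) : (M.greenEdge (x, s)).1.card = 2 := by
  rw [greenEdge, Finset.card_pair]
  simpa using (M.ne1 x).symm

theorem card_blueEdge (x : F) : (M.blueEdge x).1.card = 2 := by
  rw [blueEdge, Finset.card_pair]
  simpa using (M.ne0 x).symm

theorem card_hyperEdge (x : F) : (M.hyperEdge x).1.card = 3 := by
  rw [hyperEdge, Finset.card_eq_three]
  exact ⟨_, _, _, by simpa using (M.ne2 x).symm, by simp, by simp, rfl⟩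

theorem IsInnerColoring.card_innerEdge (hκ : M.IsInnerColoring κ) (x : F) :
    (M.innerEdge κ x).1.card = 2 := by
  rw [innerEdge, Finset.card_pair]
  simpa using hκ.halfEdgeOf_ne x

theorem hyperEdge_eq_iff (x y : F) : M.hyperEdge x = M.hyperEdge y ↔ x = y ∨ x = M.τ2 y := by
  constructor
  · intro h
    have : Sum.inl (y, Side.vert) ∈ (M.hyperEdge x).1 := h ▸ inl_mem_hyperEdge.2 (by simp)
    exact (inl_mem_hyperEdge.1 this).2
  · rintro (rfl | rfl)
    · rfl
    · exact hyperEdge_τ2 y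

/-- Only the rank-3 edges matter for a cycle operator up to gauge operators. -/
theorem mkQ_cycleOp {S : Submodule (ZMod 2) (PauliOp M.Qubit)}
    (hS : ∀ P ∈ gaugeGroup (M.fiveSquares κ), P ∈ S) {σ : Finset (ColEdge M.Qubit)}
    (hσ : ∀ e ∈ σ, e ∈ M.fiveSquares κ) (T : Finset F) (hT : ∀ x ∈ T, M.hyperEdge x ∈ σ)
    (hT2 : ∀ x ∈ T, M.τ2 x ∉ T) (hσT : ∀ e ∈ σ, e.1.card = 2 ∨ ∃ x ∈ T, e = M.hyperEdge x) :
    S.mkQ (cycleOp σ) = ∑ x ∈ T, pauliClass S .blue (.inl (x, .vert)) := by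
  -- A rank-3 edge comes from the two flags `x` and `τ2 x`, of which `T` contains at most one, so no
  -- edge is counted twice.
  have hinj : Set.InjOn M.hyperEdge T := by
    intro x hx y hy hxy
    rcases (hyperEdge_eq_iff x y).1 hxy with h | h
    · exact h
    · exact absurd (h ▸ hx) (hT2 y hy)
  have hsub : T.image M.hyperEdge ⊆ σ := by
    intro e he
    obtain ⟨x, hx, rfl⟩ := Finset.mem_image.1 he
    exact hT x hx
  rw [cycleOp, map_sum, ← Finset.sum_subset hsub, Finset.sum_image hinj]
  · exact Finset.sum_congr rfl fun x _ => mkQ_edgeOp_of_card_eq_three hS (hyperEdge_mem x)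
      (card_hyperEdge x) (inl_mem_hyperEdge.2 (by simp))
  · intro e he he'
    refine mkQ_edgeOp_eq_zero hS (hσ e he) ((hσT e he).resolve_right ?_)
    rintro ⟨x, hx, rfl⟩
    exact he' (Finset.mem_image_of_mem _ hx)

/-- The gauge group as a subspace. -/
def gaugeModule (M : EmbGraph F) (κ : F → Bool) : Submodule (ZMod 2) (PauliOp M.Qubit) :=
  AddSubgroup.toZModSubmodule 2 (gaugeGroup (M.fiveSquares κ))

theorem mem_gaugeModule {P : PauliOp M.Qubit} :
    P ∈ M.gaugeModule κ ↔ P ∈ gaugeGroup (M.fiveSquares κ) := Iff.rfl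

theorem mkQ_gaugeModule {P : PauliOp M.Qubit} :
    (M.gaugeModule κ).mkQ P = 0 ↔ P ∈ gaugeGroup (M.fiveSquares κ) := by
  simp [mem_gaugeModule]

variable [Fintype F]

/-- Commutation with the gauge group is automatic for hypercycles, so only membership has to be
checked. -/
theorem IsInnerColoring.isStabilizer (hκ : M.IsInnerColoring κ) {σ : Finset (ColEdge M.Qubit)}
    (hσ : IsHypercycle (M.fiveSquares κ) σ) (h : (M.gaugeModule κ).mkQ (cycleOp σ) = 0) :
    IsStabilizer (M.fiveSquares κ) (cycleOp σ) :=
  ⟨mkQ_gaugeModule.1 h, fun _ hg => hσ.syn_gauge hκ.isProper hg⟩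

theorem isHypercycle_cycle1 (hκ : M.IsInnerColoring κ) (f : M.Face) :
    IsHypercycle (M.fiveSquares κ) (M.cycle1 f) := by
  have hmem : ∀ e ∈ M.cycle1 f, e ∈ M.fiveSquares κ := by
    simp only [cycle1, Finset.mem_biUnion]
    rintro e ⟨x, -, hx⟩
    simp at hx
    rcases hx with rfl | rfl
    · exact greenEdge_mem _
    · exact blueEdge_mem _
  rw [isHypercycle_iff hκ.isProper hmem, M.forall_qubit]
  simp only [meets_cycle1_vert, meets_cycle1_face, meets_cycle1_inner]
  simp [CharTwo.add_self_eq_zero]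

theorem isHypercycle_cycle2 (hκ : M.IsInnerColoring κ) (v : M.Vertex) :
    IsHypercycle (M.fiveSquares κ) (M.cycle2 κ v) := by
  have hmem : ∀ e ∈ M.cycle2 κ v, e ∈ M.fiveSquares κ := by
    simp only [cycle2, Finset.mem_union, Finset.mem_biUnion, Finset.mem_image]
    rintro e (⟨x, -, hx⟩ | ⟨x, -, rfl⟩)
    · simp at hx
      rcases hx with rfl | rfl
      · exact greenEdge_mem _
      · exact hyperEdge_mem _
    · exact innerEdge_mem _
  rw [isHypercycle_iff hκ.isProper hmem, M.forall_qubit]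
  simp only [meets_cycle2_vert, meets_cycle2_face, meets_cycle2_inner hκ]
  simp [CharTwo.add_self_eq_zero]

theorem isHypercycle_cycle3 (hM : M.Bicolorable) (hκ : M.IsInnerColoring κ) (f : M.Face) :
    IsHypercycle (M.fiveSquares κ) (M.cycle3 κ f) := by
  have hmem : ∀ e ∈ M.cycle3 κ f, e ∈ M.fiveSquares κ := by
    simp only [cycle3, Finset.mem_biUnion]
    rintro e ⟨x, -, hx⟩
    simp at hx
    rcases hx with rfl | rfl | rfl | rfl | rfl
    · exact greenEdge_mem _
    · exact hyperEdge_mem _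
    · exact innerEdge_mem _
    · exact redEdge_mem _
    · exact blueEdge_mem _
  rw [isHypercycle_iff hκ.isProper hmem, M.forall_qubit]
  simp only [meets_cycle3_vert, meets_cycle3_face, meets_cycle3_inner hκ]
  refine ⟨fun x => ?_, fun x => ?_, fun x => ?_⟩
  -- The two sides of an edge are different faces, so the two ways in which the loop reaches a qubit
  -- exclude each other.
  · have := hM.faceOf_ne x
    by_cases h1 : M.faceOf x = f <;> by_cases h2 : M.faceOf (M.τ2 x) = f <;>
      simp_all [CharTwo.add_self_eq_zero]
  · simp [CharTwo.add_self_eq_zero]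
  · have := hM.faceOf_ne x
    cases hx : κ x <;> by_cases h1 : M.faceOf x = f <;> by_cases h2 : M.faceOf (M.τ2 x) = f <;>
      simp_all [CharTwo.add_self_eq_zero]

theorem isHypercycle_cycle4 (hκ : M.IsInnerColoring κ) (v : M.Vertex) :
    IsHypercycle (M.fiveSquares κ) (M.cycle4 κ v) := by
  have hmem : ∀ e ∈ M.cycle4 κ v, e ∈ M.fiveSquares κ := by
    simp only [cycle4, Finset.mem_image]
    rintro e ⟨x, -, rfl⟩
    exact innerEdge_mem _
  rw [isHypercycle_iff hκ.isProper hmem, M.forall_qubit]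
  simp only [meets_cycle4_outer, meets_cycle4_inner hκ]
  simp [CharTwo.add_self_eq_zero]

theorem isHypercycle_cycle5 (hκ : M.IsInnerColoring κ) (d : M.Corner) :
    IsHypercycle (M.fiveSquares κ) (M.cycle5 d) := by
  have hmem : ∀ e ∈ M.cycle5 d, e ∈ M.fiveSquares κ := by
    simp only [cycle5, Finset.mem_biUnion]
    rintro e ⟨x, -, hx⟩
    simp at hx
    rcases hx with rfl | rfl | rfl
    · exact greenEdge_mem _
    · exact greenEdge_mem _
    · exact redEdge_mem _
  rw [isHypercycle_iff hκ.isProper hmem, M.forall_qubit]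
  simp only [meets_cycle5_outer, meets_cycle5_inner]
  simp [CharTwo.add_self_eq_zero]

theorem isStabilizer_cycle1 (hκ : M.IsInnerColoring κ) (f : M.Face) :
    IsStabilizer (M.fiveSquares κ) (cycleOp (M.cycle1 f)) := by
  have h := isHypercycle_cycle1 hκ f
  refine hκ.isStabilizer h ?_
  rw [mkQ_cycleOp (fun _ hP => hP) h.1 ∅ (by simp) (by simp), Finset.sum_empty]
  simp only [cycle1, Finset.mem_biUnion]
  rintro e ⟨x, -, hx⟩
  simp at hx
  rcases hx with rfl | rfl <;> simp [card_greenEdge, card_blueEdge]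

theorem isStabilizer_cycle2 (hκ : M.IsInnerColoring κ) (v : M.Vertex) :
    IsStabilizer (M.fiveSquares κ) (cycleOp (M.cycle2 κ v)) := by
  have h := isHypercycle_cycle2 hκ v
  refine hκ.isStabilizer h ?_
  rw [mkQ_cycleOp (fun _ hP => hP) h.1 {x | M.vertexOf x = v ∧ κ x = true},
    sum_blue_vert (fun _ hP => hP) hκ hκ.2]
  · intro x hx
    simp only [cycle2, Finset.mem_union, Finset.mem_biUnion]
    exact Or.inl ⟨x, by simp_all, by simp⟩
  · simp +contextual [hκ.2]
  · simp only [cycle2, Finset.mem_union, Finset.mem_biUnion, Finset.mem_image]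
    rintro e (⟨x, hv, hx⟩ | ⟨x, -, rfl⟩)
    · simp at hx
      rcases hx with rfl | rfl
      · exact Or.inl (card_greenEdge _ _)
      · right
        cases hc : κ x
        · exact ⟨M.τ2 x, by simp_all [hκ.2], (hyperEdge_τ2 x).symm⟩
        · exact ⟨x, by simp_all, rfl⟩
    · exact Or.inl (hκ.card_innerEdge x)

theorem isStabilizer_cycle3 (hM : M.Bicolorable) (hκ : M.IsInnerColoring κ) (f : M.Face) :
    IsStabilizer (M.fiveSquares κ) (cycleOp (M.cycle3 κ f)) := by
  have h := isHypercycle_cycle3 hM hκ f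
  refine hκ.isStabilizer h ?_
  -- The `Z` operators left by the rank-3 edges move across the e-faces to the boundary of `f`,
  -- where blue edges cancel them in pairs.
  rw [mkQ_cycleOp (fun _ hP => hP) h.1 {x | M.faceOf x = f},
    sum_blue_vert_eq_face (fun _ hP => hP) (by simp), sum_blue_face (fun _ hP => hP) (by simp)]
  · intro x hx
    simp only [cycle3, Finset.mem_biUnion]
    exact ⟨x, hx, by simp⟩
  · intro x hx hx'
    simp only [Finset.mem_filter, Finset.mem_univ, true_and] at hx hx'
    exact hM.faceOf_ne x (hx.trans hx'.symm)
  · simp only [cycle3, Finset.mem_biUnion]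
    rintro e ⟨x, hf, hx⟩
    simp at hx
    rcases hx with rfl | rfl | rfl | rfl | rfl
    · exact Or.inl (card_greenEdge _ _)
    · exact Or.inr ⟨x, hf, rfl⟩
    · exact Or.inl (hκ.card_innerEdge _)
    · exact Or.inl (card_redEdge _ _)
    · exact Or.inl (card_blueEdge _)

theorem isStabilizer_cycle4 (hκ : M.IsInnerColoring κ) (v : M.Vertex) :
    IsStabilizer (M.fiveSquares κ) (cycleOp (M.cycle4 κ v)) := by
  have h := isHypercycle_cycle4 hκ v
  refine hκ.isStabilizer h ?_
  rw [mkQ_cycleOp (fun _ hP => hP) h.1 ∅ (by simp) (by simp), Finset.sum_empty]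
  simp only [cycle4, Finset.mem_image]
  rintro e ⟨x, -, rfl⟩
  exact Or.inl (hκ.card_innerEdge x)

theorem isStabilizer_cycle5 (hκ : M.IsInnerColoring κ) (d : M.Corner) :
    IsStabilizer (M.fiveSquares κ) (cycleOp (M.cycle5 d)) := by
  have h := isHypercycle_cycle5 hκ d
  refine hκ.isStabilizer h ?_
  rw [mkQ_cycleOp (fun _ hP => hP) h.1 ∅ (by simp) (by simp), Finset.sum_empty]
  simp only [cycle5, Finset.mem_biUnion]
  rintro e ⟨x, -, hx⟩
  simp at hx
  rcases hx with rfl | rfl | rfl <;> simp [card_greenEdge, card_redEdge]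

end EmbGraph

theorem zOn_eq {V : Type*} (A : Finset V) : zOn A = (0, fun v => if v ∈ A then 1 else 0) := by
  ext v <;>
    simp [zOn, EdgeColor.pauli, Prod.fst_sum, Prod.snd_sum, Finset.sum_apply, Pi.single_apply]

namespace EmbGraph

variable {F : Type*} {M : EmbGraph F} {κ : F → Bool}

/-! ### Residual patterns -/

/-- The rotation of the faces. -/
def rotation (M : EmbGraph F) : Equiv.Perm F :=
  Function.Involutive.toPerm M.τ1 M.inv1 * Function.Involutive.toPerm M.τ0 M.inv0

theorem rotation_apply (x : F) : M.rotation x = M.τ1 (M.τ0 x) := rfl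

theorem τ0_rotation_zpow (i : ℤ) (x : F) :
    M.τ0 ((M.rotation ^ i) x) = (M.rotation ^ (-i)) (M.τ0 x) := by
  have h : Function.Involutive.toPerm M.τ0 M.inv0 * M.rotation *
      (Function.Involutive.toPerm M.τ0 M.inv0)⁻¹ = M.rotation⁻¹ := by
    rw [rotation, mul_assoc, mul_assoc, mul_inv_cancel, mul_one, mul_inv_rev]
    rfl
  have h' := conj_zpow (a := Function.Involutive.toPerm M.τ0 M.inv0) (b := M.rotation) (i := i)
  rw [h, inv_zpow'] at h'
  rw [h']
  change _ = M.τ0 ((M.rotation ^ i) (M.τ0 (M.τ0 x)))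
  rw [τ0_τ0]

/-- On a rotation cycle containing both flags, `τ0` would act as the reflection `j ↦ i - j`. For
even `i` this gives a fixed point of `τ0`, for odd `i` one of `τ1`; neither exists. -/
theorem not_sameCycle_τ0 (x : F) : ¬ M.rotation.SameCycle x (M.τ0 x) := by
  rintro ⟨i, hi⟩
  have h : ∀ j, M.τ0 ((M.rotation ^ j) x) = (M.rotation ^ (i - j)) x := by
    intro j
    rw [τ0_rotation_zpow, ← hi, ← Equiv.Perm.mul_apply, ← zpow_add, neg_add_eq_sub]
  rcases Int.even_or_odd' i with ⟨j, rfl | rfl⟩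
  · refine M.ne0 _ ((h j).trans ?_)
    rw [two_mul, add_sub_cancel_right]
  · refine M.ne1 (M.τ0 ((M.rotation ^ j) x)) (Eq.symm ((h j).trans ?_))
    rw [← rotation_apply, ← Equiv.Perm.mul_apply, ← zpow_one_add]
    congr 2
    ring

theorem sameCycle_τ0_iff {x y : F} :
    M.rotation.SameCycle (M.τ0 x) y ↔ M.rotation.SameCycle x (M.τ0 y) := by
  have h : ∀ x y, M.rotation.SameCycle x y → M.rotation.SameCycle (M.τ0 x) (M.τ0 y) := by
    rintro x _ ⟨i, rfl⟩
    exact ⟨-i, (τ0_rotation_zpow i x).symm⟩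
  refine ⟨fun h' => ?_, fun h' => ?_⟩
  · simpa using h _ _ h'
  · simpa using h _ _ h'

theorem sameCycle_τ1_right {x y : F} :
    M.rotation.SameCycle x (M.τ1 y) ↔ M.rotation.SameCycle x (M.τ0 y) := by
  have h : M.τ1 y = M.rotation (M.τ0 y) := by simp [rotation_apply]
  rw [h, Equiv.Perm.sameCycle_apply_right]

theorem sameCycle_of_faceOf_eq {x y : F} (h : M.faceOf x = M.faceOf y) :
    M.rotation.SameCycle x y ∨ M.rotation.SameCycle x (M.τ0 y) := by
  let f : M.Face → Set F := Quot.lift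
    (fun x => {z | M.rotation.SameCycle x z ∨ M.rotation.SameCycle x (M.τ0 z)}) (by
      have h0 : ∀ x, {z | M.rotation.SameCycle x z ∨ M.rotation.SameCycle x (M.τ0 z)} =
          {z | M.rotation.SameCycle (M.τ0 x) z ∨ M.rotation.SameCycle (M.τ0 x) (M.τ0 z)} := by
        intro x
        ext z
        simp only [Set.mem_ofPred_eq, sameCycle_τ0_iff, τ0_τ0]
        exact or_comm
      rintro x _ (rfl | rfl)
      · have h1 : M.dual.τ1 x = M.rotation (M.τ0 x) := by simp [rotation_apply]
        simp only [h1, Equiv.Perm.sameCycle_apply_left]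
        exact h0 x
      · exact h0 x)
  have hy : y ∈ f (M.faceOf y) := Or.inl (Equiv.Perm.SameCycle.refl _ _)
  rw [← h] at hy
  exact hy

/-- The flags of a face form two rotation cycles, one for each direction of its boundary, and both
`τ0` and `τ1` exchange them. Choosing a base flag on every face selects one of the two. -/
theorem exists_isResidualPattern [Fintype F] (M : EmbGraph F) : ∃ Ω, M.IsResidualPattern Ω := by
  have h0 : ∀ r x, M.faceOf r = M.faceOf x →
      (M.rotation.SameCycle r x ↔ ¬ M.rotation.SameCycle r (M.τ0 x)) := by
    refine fun r x h => ⟨fun h1 h2 => not_sameCycle_τ0 x (h1.symm.trans h2), fun h1 => ?_⟩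
    exact (sameCycle_of_faceOf_eq h).resolve_right h1
  have hr := Function.surjInv_eq M.faceOf_surjective
  refine ⟨Finset.univ.filter fun x =>
    M.rotation.SameCycle (Function.surjInv M.faceOf_surjective (M.faceOf x)) x,
    fun x => ?_, fun x => ?_⟩
  · simp only [Finset.mem_filter, Finset.mem_univ, true_and, faceOf_τ1, sameCycle_τ1_right]
    exact h0 _ x (hr _)
  · simp only [Finset.mem_filter, Finset.mem_univ, true_and, faceOf_τ0]
    exact h0 _ x (hr _)

variable {Ω : Finset F} {c : M.Face → Bool}

theorem IsResidualPattern.mem_τ0 (hΩ : M.IsResidualPattern Ω) (x : F) :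
    M.τ0 x ∈ Ω ↔ x ∉ Ω := by
  rw [hΩ.2 x, not_not]

theorem sum_residual {A : Type*} [AddCommMonoid A] (B : Finset F) (g : M.Qubit → A) :
    ∑ q ∈ B.image (fun x => (Sum.inl (x, Side.face) : M.Qubit)), g q =
      ∑ x ∈ B, g (.inl (x, .face)) :=
  Finset.sum_image fun x _ y _ h => by simpa using h

theorem mkQ_residualError (S : Submodule (ZMod 2) (PauliOp M.Qubit)) (A : Finset F) :
    S.mkQ (M.residualError A) = ∑ x ∈ A, pauliClass S .blue (.inl (x, .face)) := by
  rw [residualError, mkQ_zOn, sum_residual]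

/-- The class modulo gauge operators of the lift to `B` of the `Z` part of a Pauli operator on the
dual edges. -/
noncomputable def liftClass (M : EmbGraph F) (κ : F → Bool) (B : Finset F) :
    PauliOp M.dual.Edge →+ PauliOp M.Qubit ⧸ M.gaugeModule κ where
  toFun P := ∑ x ∈ B, P.2 (M.dual.edgeOf x) • pauliClass _ .blue (.inl (x, .face))
  map_zero' := by simp
  map_add' P Q := by simp [add_smul, Finset.sum_add_distrib]

theorem liftClass_apply (B : Finset F) (P : PauliOp M.dual.Edge) : M.liftClass κ B P =
    ∑ x ∈ B, P.2 (M.dual.edgeOf x) • pauliClass _ .blue (.inl (x, .face)) := rfl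

theorem liftClass_zOn (B : Finset F) (D : Finset M.dual.Edge) :
    M.liftClass κ B (zOn D) = (M.gaugeModule κ).mkQ (M.residualError (M.lift B D)) := by
  rw [liftClass_apply, zOn_eq, mkQ_residualError, lift, Finset.sum_filter]
  refine Finset.sum_congr rfl fun x _ => ?_
  split_ifs <;> simp [*]

/-- The qubits of a pattern on the faces of one colour map bijectively to the dual edges. -/
theorem IsResidualPattern.bijOn_edgeOf (hΩ : M.IsResidualPattern Ω)
    (hc : M.IsFaceColoring fun x => c (M.faceOf x)) (b : Bool) :
    Set.BijOn M.dual.edgeOf (Ω.filter fun x => c (M.faceOf x) = b) Set.univ := by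
  refine ⟨fun _ _ => trivial, ?_, ?_⟩
  · intro x hx y hy hxy
    simp only [Finset.coe_filter, Set.mem_ofPred_eq] at hx hy
    -- Among the flags of an edge, `τ0` changes membership in `Ω` and keeps the face, while `τ2`
    -- changes the face colour; only equality is left.
    rcases M.dual_edgeOf_eq_iff.1 hxy with h | h | h | h
    · exact h
    · exact absurd hy.1 ((hΩ.mem_τ0 y).1 (h ▸ hx.1))
    · have := hc.τ2 y
      rw [← h] at this
      simp [hx.2, hy.2] at this
    · have := (hc.τ0 (M.τ2 y)).trans (hc.τ2 y)
      rw [← h] at this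
      simp [hx.2, hy.2] at this
  · intro e _
    obtain ⟨x, rfl⟩ := M.dual.edgeOf_surjective e
    obtain ⟨y, hy, hyb⟩ : ∃ y, M.dual.edgeOf y = M.dual.edgeOf x ∧ c (M.faceOf y) = b := by
      by_cases h : c (M.faceOf x) = b
      · exact ⟨x, rfl, h⟩
      · refine ⟨M.τ2 x, M.dual.edgeOf_τ0 x, ?_⟩
        have : c (M.faceOf (M.τ2 x)) = !c (M.faceOf x) := hc.τ2 x
        rw [this]
        cases b <;> simpa using h
    by_cases h : y ∈ Ω
    · exact ⟨y, by simp [h, hyb], hy⟩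
    · exact ⟨M.τ0 y, by simp [hΩ.mem_τ0, h, hyb], (M.dual.edgeOf_τ2 y).trans hy⟩

/-! ### Syndromes of residual errors -/

variable [Fintype F]

theorem syn_cycle1_residualError (hκ : M.IsInnerColoring κ) (f : M.Face) (A : Finset F) :
    PauliOp.syn (cycleOp (M.cycle1 f)) (M.residualError A) =
      ∑ x ∈ A, if M.faceOf x = f then 1 else 0 := by
  rw [residualError, PauliOp.syn_zOn, sum_residual]
  simp [(isHypercycle_cycle1 hκ f).cycleOp_fst hκ.isProper, meets_cycle1_face]

theorem syn_cycle3_residualError (hM : M.Bicolorable) (hκ : M.IsInnerColoring κ) (f : M.Face)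
    (A : Finset F) : PauliOp.syn (cycleOp (M.cycle3 κ f)) (M.residualError A) =
      ∑ x ∈ A, if M.faceOf (M.τ2 x) = f then 1 else 0 := by
  rw [residualError, PauliOp.syn_zOn, sum_residual]
  simp [(isHypercycle_cycle3 hM hκ f).cycleOp_fst hκ.isProper, meets_cycle3_face]

/-- Every incidence of an edge with a vertex carries two flags. -/
theorem card_flags_div_two (M : EmbGraph F) (v : M.Vertex) (x : F) {p : F → Prop}
    (hp : ∀ y, p y ↔ y = x ∨ y = M.τ0 x ∨ y = M.τ2 x ∨ y = M.τ0 (M.τ2 x)) :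
    (Finset.univ.filter fun y => M.vertexOf y = v ∧ p y).card / 2 =
      (if M.vertexOf x = v then 1 else 0) + if M.vertexOf (M.τ0 x) = v then 1 else 0 := by
  have h : (Finset.univ.filter fun y => M.vertexOf y = v ∧ p y) =
      ({x, M.τ0 x, M.τ2 x, M.τ0 (M.τ2 x)} : Finset F).filter fun y => M.vertexOf y = v := by
    ext y
    simp [hp, and_comm]
  have h1 : x ∉ ({M.τ0 x, M.τ2 x, M.τ0 (M.τ2 x)} : Finset F) := by
    simpa using ⟨(M.ne0 x).symm, (M.ne2 x).symm, (M.ne02 x).symm⟩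
  have h2 : M.τ0 x ∉ ({M.τ2 x, M.τ0 (M.τ2 x)} : Finset F) := by
    have := M.ne02 (M.τ2 x)
    have h3 := M.ne2 (M.τ0 x)
    rw [τ2_τ2] at this
    rw [← M.comm02] at h3
    simpa using ⟨this, h3.symm⟩
  have h3 : M.τ2 x ∉ ({M.τ0 (M.τ2 x)} : Finset F) := by
    simpa using (M.ne0 (M.τ2 x)).symm
  rw [h, Finset.card_filter, Finset.sum_insert h1, Finset.sum_insert h2, Finset.sum_insert h3,
    Finset.sum_singleton, M.comm02, vertexOf_τ2, vertexOf_τ2]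
  omega

theorem dual_vertexOp_edgeOf (f : M.Face) (x : F) :
    (M.dual.vertexOp f).1 (M.dual.edgeOf x) =
      (if M.faceOf x = f then 1 else 0) + if M.faceOf (M.τ2 x) = f then 1 else 0 := by
  simp only [vertexOp]
  rw [card_flags_div_two M.dual f x fun y => M.dual.edgeOf_eq_iff]
  push_cast
  rfl

theorem dual_plaquetteOp_edgeOf (v : M.Vertex) (x : F) :
    (M.dual.plaquetteOp v).2 (M.dual.edgeOf x) =
      (if M.vertexOf x = v then 1 else 0) + if M.vertexOf (M.τ0 x) = v then 1 else 0 := by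
  have h := card_flags_div_two M v x fun y => M.dual_edgeOf_eq_iff (x := y)
  have h' := congrArg (fun n : ℕ => (n : ZMod 2)) h
  push_cast at h'
  exact h'

theorem IsResidualPattern.syn_projectedError (hΩ : M.IsResidualPattern Ω)
    (hc : M.IsFaceColoring fun x => c (M.faceOf x)) (b : Bool) (f : M.Face) (A : Finset F) :
    PauliOp.syn (M.dual.vertexOp f)
        (M.projectedError (A ∩ Ω.filter fun x => c (M.faceOf x) = b)) =
      ∑ x ∈ A ∩ Ω.filter fun x => c (M.faceOf x) = b,
        ((if M.faceOf x = f then 1 else 0) + if M.faceOf (M.τ2 x) = f then 1 else 0) := by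
  rw [projectedError, PauliOp.syn_zOn, Finset.sum_image]
  · exact Finset.sum_congr rfl fun x _ => dual_vertexOp_edgeOf f x
  · exact (hΩ.bijOn_edgeOf hc b).injOn.mono fun x hx => (Finset.mem_inter.1 hx).2

/-- For flags on faces coloured like `f`, the face across the edge has the other colour, so only the
near end can be `f`. Flags on faces of the other colour contribute nothing to S1. For S3 the two
ends exchange roles. -/
theorem IsResidualPattern.syn_cycle1 (hΩ : M.IsResidualPattern Ω)
    (hκ : M.IsInnerColoring κ) (hc : M.IsFaceColoring fun x => c (M.faceOf x)) {f : M.Face}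
    {A : Finset F} (hA : A ⊆ Ω) :
    PauliOp.syn (cycleOp (M.cycle1 f)) (M.residualError A) = PauliOp.syn (M.dual.vertexOp f)
      (M.projectedError (A ∩ Ω.filter fun x => c (M.faceOf x) = c f)) := by
  rw [hΩ.syn_projectedError hc, syn_cycle1_residualError hκ]
  symm
  refine Eq.trans (Finset.sum_congr rfl fun x hx => ?_)
    (Finset.sum_subset Finset.inter_subset_left fun x hx hx' => ?_)
  · have h2 := hc.τ2 x
    simp only [Finset.mem_inter, Finset.mem_filter] at hx
    simp only [hx.2.2] at h2
    have h : M.faceOf (M.τ2 x) ≠ f := by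
      intro h
      rw [h] at h2
      simp at h2
    rw [if_neg h, add_zero]
  · refine if_neg fun h => hx' ?_
    simp [hx, hA hx, h]

theorem IsResidualPattern.syn_cycle3 (hΩ : M.IsResidualPattern Ω) (hM : M.Bicolorable)
    (hκ : M.IsInnerColoring κ) (hc : M.IsFaceColoring fun x => c (M.faceOf x)) {f : M.Face}
    {A : Finset F} (hA : A ⊆ Ω) :
    PauliOp.syn (cycleOp (M.cycle3 κ f)) (M.residualError A) = PauliOp.syn (M.dual.vertexOp f)
      (M.projectedError (A ∩ Ω.filter fun x => c (M.faceOf x) = !c f)) := by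
  rw [hΩ.syn_projectedError hc, syn_cycle3_residualError hM hκ]
  symm
  refine Eq.trans (Finset.sum_congr rfl fun x hx => ?_)
    (Finset.sum_subset Finset.inter_subset_left fun x hx hx' => ?_)
  · simp only [Finset.mem_inter, Finset.mem_filter] at hx
    have h : M.faceOf x ≠ f := by
      intro h
      have := hx.2.2
      rw [h] at this
      simp at this
    rw [if_neg h, zero_add]
  · refine if_neg fun h => hx' ?_
    have h2 := hc.τ2 x
    simp only [h] at h2
    simp [hx, hA hx, h2]

/-! ### Lifting the stabilizer of the surface code -/

theorem lift_projection {B : Finset F} (hB : Set.InjOn M.dual.edgeOf B) (A : Finset F) :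
    M.lift B ((A ∩ B).image M.dual.edgeOf) = A ∩ B := by
  ext x
  simp only [lift, Finset.mem_filter, Finset.mem_image, Finset.mem_inter]
  constructor
  · rintro ⟨hx, y, ⟨hyA, hyB⟩, hy⟩
    exact hB hyB hx hy ▸ ⟨hyA, hyB⟩
  · rintro ⟨hxA, hxB⟩
    exact ⟨hxB, x, ⟨hxA, hxB⟩, rfl⟩

/-- The face colour picks one flag from each half-edge at `v`, so `sum_blue_vert` applies. As the
colour is constant on corners, its relation moves across the e-faces to the outer qubits, and from
there along blue edges into `Ω`. -/
theorem IsResidualPattern.liftClass_plaquetteOp (hΩ : M.IsResidualPattern Ω)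
    (hκ : M.IsInnerColoring κ) (hc : M.IsFaceColoring fun x => c (M.faceOf x)) (b : Bool)
    (v : M.Vertex) :
    M.liftClass κ (Ω.filter fun x => c (M.faceOf x) = b) (M.dual.plaquetteOp v) = 0 := by
  have hS : ∀ P ∈ gaugeGroup (M.fiveSquares κ), P ∈ M.gaugeModule κ := fun _ hP => hP
  have hd : ∀ x, (c (M.faceOf (M.τ2 x)) == b) = !(c (M.faceOf x) == b) := by
    intro x
    have : c (M.faceOf (M.τ2 x)) = !c (M.faceOf x) := hc.τ2 x
    rw [this]
    cases c (M.faceOf x) <;> cases b <;> rfl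
  have hsum := sum_blue_vert_eq_face hS
    (p := fun x => M.vertexOf x = v ∧ (c (M.faceOf x) == b) = true) (by simp)
  rw [sum_blue_vert (d := fun x => c (M.faceOf x) == b) hS hκ hd] at hsum
  rw [liftClass_apply]
  simp only [dual_plaquetteOp_edgeOf, add_smul, Finset.sum_add_distrib, ite_smul, one_smul,
    zero_smul]
  -- The flags at `v` in `Ω` give the near ends of the dual edges' crossing edges. The others pass
  -- under `τ0` into `Ω` and give the far ends.
  refine Eq.trans ?_ ((Finset.sum_filter_add_sum_filter_not _ (fun x => x ∈ Ω) _).trans hsum.symm)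
  congr 1
  · rw [← Finset.sum_filter, Finset.filter_filter, Finset.filter_filter]
    refine Finset.sum_congr ?_ fun _ _ => rfl
    ext x
    simp
    tauto
  · rw [← Finset.sum_filter, Finset.filter_filter, Finset.filter_filter]
    refine Finset.sum_nbij' M.τ0 M.τ0 ?_ ?_ (fun x _ => M.inv0 x) (fun x _ => M.inv0 x)
      fun x _ => (pauliClass_blue_τ0 hS x).symm
    · intro x hx
      simp [hΩ.mem_τ0] at hx ⊢
      tauto
    · intro x hx
      simp [hΩ.mem_τ0] at hx ⊢
      tauto

theorem IsResidualPattern.liftClass_eq_zero (hΩ : M.IsResidualPattern Ω)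
    (hκ : M.IsInnerColoring κ) (hc : M.IsFaceColoring fun x => c (M.faceOf x)) (b : Bool)
    {P : PauliOp M.dual.Edge} (hP : P ∈ M.dual.surfaceStabilizer) :
    M.liftClass κ (Ω.filter fun x => c (M.faceOf x) = b) P = 0 := by
  suffices h : M.dual.surfaceStabilizer ≤
      (M.liftClass κ (Ω.filter fun x => c (M.faceOf x) = b)).ker from h hP
  rw [surfaceStabilizer, AddSubgroup.closure_le]
  rintro _ (⟨f, rfl⟩ | ⟨v, rfl⟩)
  · simp [liftClass_apply, vertexOp]
  · exact hΩ.liftClass_plaquetteOp hκ hc b v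

theorem IsResidualPattern.mkQ_residualError_eq (hΩ : M.IsResidualPattern Ω)
    (hκ : M.IsInnerColoring κ) (hc : M.IsFaceColoring fun x => c (M.faceOf x)) (b : Bool)
    {A : Finset F} {D : Finset M.dual.Edge}
    (h : M.projectedError (A ∩ Ω.filter fun x => c (M.faceOf x) = b) + zOn D ∈
      M.dual.surfaceStabilizer) :
    (M.gaugeModule κ).mkQ (M.residualError (A ∩ Ω.filter fun x => c (M.faceOf x) = b)) =
      (M.gaugeModule κ).mkQ
        (M.residualError (M.lift (Ω.filter fun x => c (M.faceOf x) = b) D)) := by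
  have h0 := hΩ.liftClass_eq_zero hκ hc b h
  rw [map_add, projectedError, liftClass_zOn, liftClass_zOn,
    lift_projection (hΩ.bijOn_edgeOf hc b).injOn] at h0
  rwa [← sub_eq_zero, ZModModule.sub_eq_add]

end EmbGraph

/-! ### Errors with trivial S2, S4 and S5 syndromes -/

/-- Products of `Z` operators on the qubits in `T`. -/
def zSupported {V : Type*} (T : Set V) : Submodule (ZMod 2) (PauliOp V) where
  carrier := {P | P.1 = 0 ∧ ∀ v ∉ T, P.2 v = 0}
  zero_mem' := ⟨rfl, fun _ _ => rfl⟩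
  add_mem' := by
    rintro P Q ⟨hP, hP'⟩ ⟨hQ, hQ'⟩
    exact ⟨by simp [hP, hQ], fun v hv => by simp [hP' v hv, hQ' v hv]⟩
  smul_mem' := by
    rintro a P ⟨hP, hP'⟩
    exact ⟨by simp [hP], fun v hv => by simp [hP' v hv]⟩

theorem blue_mem_zSupported {V : Type*} {T : Set V} {v : V} (hv : v ∈ T) :
    EdgeColor.blue.pauli v ∈ zSupported T := by
  refine ⟨rfl, fun w hw => ?_⟩
  have : w ≠ v := fun h => hw (h ▸ hv)
  simp [EdgeColor.pauli, this]

namespace EmbGraph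

variable {F : Type*} {M : EmbGraph F} {κ : F → Bool}

/-- The component of a qubit in the hypergraph of the red and the green edges: an e-face or an inner
face. -/
def redGreenComponent (M : EmbGraph F) : M.Qubit → M.Corner ⊕ M.Vertex
  | .inl (x, _) => .inl (M.cornerOf x)
  | .inr h => .inr h.vertex

/-- The vertex under a qubit, unless the qubit lies on the v-face of a face. -/
def innerVertex (M : EmbGraph F) : M.Qubit → Option M.Vertex
  | .inl (x, .vert) => some (M.vertexOf x)
  | .inl (_, .face) => none
  | .inr h => some h.vertex

section Fintype

variable [Fintype F]

theorem syn_cycle5 (hκ : M.IsInnerColoring κ) (d : M.Corner) (E : PauliOp M.Qubit) :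
    PauliOp.syn (cycleOp (M.cycle5 d)) E =
      ∑ q, if M.redGreenComponent q = .inl d then E.1 q else 0 := by
  refine Finset.sum_congr rfl fun q _ => ?_
  have h := isHypercycle_cycle5 hκ d
  rw [h.cycleOp_fst hκ.isProper, h.cycleOp_snd hκ.isProper]
  revert q
  rw [M.forall_qubit]
  simp only [meets_cycle5_outer, meets_cycle5_inner, redGreenComponent]
  simp

theorem syn_cycle4 (hκ : M.IsInnerColoring κ) (v : M.Vertex) (E : PauliOp M.Qubit) :
    PauliOp.syn (cycleOp (M.cycle4 κ v)) E =
      ∑ q, if M.redGreenComponent q = .inr v then E.1 q else 0 := by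
  refine Finset.sum_congr rfl fun q _ => ?_
  have h := isHypercycle_cycle4 hκ v
  rw [h.cycleOp_fst hκ.isProper, h.cycleOp_snd hκ.isProper]
  revert q
  rw [M.forall_qubit]
  simp only [meets_cycle4_outer, meets_cycle4_inner hκ, redGreenComponent]
  simp

/-- Every qubit of the v-face and of its inner face is met in green and blue, so the operator is `X`
there and detects the `Z` part. -/
theorem syn_cycle2 (hκ : M.IsInnerColoring κ) (v : M.Vertex) (E : PauliOp M.Qubit) :
    PauliOp.syn (cycleOp (M.cycle2 κ v)) E =
      ∑ q, if M.innerVertex q = some v then E.2 q else 0 := by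
  refine Finset.sum_congr rfl fun q _ => ?_
  have h := isHypercycle_cycle2 hκ v
  rw [h.cycleOp_fst hκ.isProper, h.cycleOp_snd hκ.isProper]
  revert q
  rw [M.forall_qubit]
  simp only [meets_cycle2_vert, meets_cycle2_face, meets_cycle2_inner hκ, innerVertex]
  simp

/-- An error with trivial S4 and S5 syndromes has no `X` part up to gauge operators. -/
theorem IsInnerColoring.exists_z_error (hκ : M.IsInnerColoring κ) {E : PauliOp M.Qubit}
    (h4 : ∀ v, PauliOp.syn (cycleOp (M.cycle4 κ v)) E = 0)
    (h5 : ∀ d, PauliOp.syn (cycleOp (M.cycle5 d)) E = 0) :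
    ∃ g ∈ gaugeGroup (M.fiveSquares κ), ∃ z : PauliOp M.Qubit, z.1 = 0 ∧ g + z = E := by
  -- With all `Z` operators adjoined, green and red classes agree, so the class of `X` depends only
  -- on the red-green component. The S4 and S5 syndromes are then the total weights on the
  -- components.
  let S := M.gaugeModule κ ⊔ zSupported Set.univ
  have hS : ∀ P ∈ gaugeGroup (M.fiveSquares κ), P ∈ S := fun P hP =>
    Submodule.mem_sup_left hP
  have hblue : ∀ q, pauliClass S .blue q = 0 := fun q =>
    (Submodule.Quotient.mk_eq_zero S).2
      (Submodule.mem_sup_right (blue_mem_zSupported (Set.mem_univ q)))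
  have hgreen : ∀ q, pauliClass S .green q = pauliClass S .red q := fun q => by
    rw [pauliClass_green, hblue, add_zero]
  let g : M.Corner ⊕ M.Vertex → PauliOp M.Qubit ⧸ S := Sum.elim
    (Quot.lift (fun x => pauliClass S .red (.inl (x, .vert))) (by
      rintro x _ rfl
      rw [← hgreen, ← hgreen, pauliClass_green_τ1 hS]))
    (Quot.lift (fun x => pauliClass S .red (.inr (M.halfEdgeOf x))) (by
      rintro x _ (rfl | rfl)
      · have := pauliClass_inner hS x
        cases hx : κ x <;> simp only [hx, if_true, hgreen] at this <;> exact this.symm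
      · rw [halfEdgeOf_τ2]))
  have hg : ∀ q, pauliClass S .red q = g (M.redGreenComponent q) := by
    rw [M.forall_qubit]
    exact ⟨fun x => rfl, fun x => (pauliClass_red_vert hS x).symm, fun x => rfl⟩
  have hE : S.mkQ E = 0 := by
    rw [mkQ_eq_sum]
    simp only [hblue, smul_zero, Finset.sum_const_zero, add_zero, hg]
    refine sum_smul_eq_zero_of_fiber _ _ _ ?_
    rintro (d | v)
    · rw [← syn_cycle5 hκ]
      exact Or.inr (h5 d)
    · rw [← syn_cycle4 hκ]
      exact Or.inr (h4 v)
  obtain ⟨g, hg, z, hz, h⟩ := Submodule.mem_sup.1 ((Submodule.Quotient.mk_eq_zero S).1 hE)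
  exact ⟨g, hg, z, hz.1, h⟩

/-- A `Z` error with trivial S2 syndromes is supported on a residual pattern up to gauge
operators. -/
theorem IsResidualPattern.exists_of_z_error {Ω : Finset F} (hΩ : M.IsResidualPattern Ω)
    (hκ : M.IsInnerColoring κ) {z : PauliOp M.Qubit} (hz : z.1 = 0)
    (h2 : ∀ v, PauliOp.syn (cycleOp (M.cycle2 κ v)) z = 0) :
    ∃ A ⊆ Ω, z + M.residualError A ∈ gaugeGroup (M.fiveSquares κ) := by
  let T : Set M.Qubit := {q | ∃ x ∈ Ω, q = .inl (x, .face)}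
  -- Adjoining the `Z` operators on `Ω` kills all outer `Z` classes. The e-face relations and rank-3
  -- edges then make the remaining ones constant over each vertex of `M`, with total weight the S2
  -- syndrome.
  let S := M.gaugeModule κ ⊔ zSupported T
  have hS : ∀ P ∈ gaugeGroup (M.fiveSquares κ), P ∈ S := fun P hP =>
    Submodule.mem_sup_left hP
  have hΩ0 : ∀ x ∈ Ω, pauliClass S .blue (.inl (x, .face)) = 0 := fun x hx =>
    (Submodule.Quotient.mk_eq_zero S).2
      (Submodule.mem_sup_right (blue_mem_zSupported ⟨x, hx, rfl⟩))
  have hface : ∀ x, pauliClass S .blue (.inl (x, .face)) = 0 := by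
    intro x
    by_cases hx : x ∈ Ω
    · exact hΩ0 x hx
    · rw [← pauliClass_blue_τ0 hS]
      exact hΩ0 _ ((hΩ.mem_τ0 x).2 hx)
  let g : Option M.Vertex → PauliOp M.Qubit ⧸ S := fun o => o.elim 0
    (Quot.lift (fun x => pauliClass S .blue (.inr (M.halfEdgeOf x))) (by
      rintro x _ (rfl | rfl)
      · have := pauliClass_blue_square hS x
        rw [hface, hface, add_zero, add_zero, pauliClass_blue_vert hS,
          pauliClass_blue_vert hS] at this
        rwa [← sub_eq_zero, ZModModule.sub_eq_add]
      · rw [halfEdgeOf_τ2]))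
  have hg : ∀ q, pauliClass S .blue q = g (M.innerVertex q) := by
    rw [M.forall_qubit]
    exact ⟨pauliClass_blue_vert hS, hface, fun x => rfl⟩
  have hE : S.mkQ z = 0 := by
    rw [mkQ_eq_sum, hz]
    simp only [Pi.zero_apply, zero_smul, Finset.sum_const_zero, zero_add, hg]
    refine sum_smul_eq_zero_of_fiber _ _ _ ?_
    rintro (_ | v)
    · exact Or.inl rfl
    · rw [← syn_cycle2 hκ]
      exact Or.inr (h2 v)
  obtain ⟨g, hg, s, hs, h⟩ := Submodule.mem_sup.1 ((Submodule.Quotient.mk_eq_zero S).1 hE)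
  -- The component of `z` in the adjoined subspace is itself a residual error, and its support is
  -- the required `A`.
  have hres : M.residualError (Ω.filter fun x => s.2 (.inl (x, .face)) = 1) = s := by
    rw [residualError, zOn_eq]
    refine Prod.ext hs.1.symm (funext fun q => ?_)
    by_cases hq : q ∈ T
    · obtain ⟨x, hx, rfl⟩ := hq
      have h01 : ∀ a : ZMod 2, (if a = 1 then 1 else 0) = a := by decide
      simpa [hx] using h01 (s.2 (.inl (x, .face)))
    · rw [hs.2 q hq]
      refine if_neg fun hq' => hq ?_
      obtain ⟨x, hx, rfl⟩ := Finset.mem_image.1 hq'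
      exact ⟨x, (Finset.mem_filter.1 hx).1, rfl⟩
  refine ⟨Ω.filter fun x => s.2 (.inl (x, .face)) = 1, Finset.filter_subset _ _, ?_⟩
  rw [hres, ← h, add_assoc, ZModModule.add_self, add_zero]
  exact hg

theorem IsResidualPattern.exists_equivalent {Ω : Finset F} (hΩ : M.IsResidualPattern Ω)
    (hκ : M.IsInnerColoring κ) {E : PauliOp M.Qubit}
    (h2 : ∀ v, PauliOp.syn (cycleOp (M.cycle2 κ v)) E = 0)
    (h4 : ∀ v, PauliOp.syn (cycleOp (M.cycle4 κ v)) E = 0)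
    (h5 : ∀ d, PauliOp.syn (cycleOp (M.cycle5 d)) E = 0) :
    ∃ A ⊆ Ω, E + M.residualError A ∈ gaugeGroup (M.fiveSquares κ) := by
  obtain ⟨g, hg, z, hz, rfl⟩ := hκ.exists_z_error h4 h5
  obtain ⟨A, hA, h⟩ := hΩ.exists_of_z_error hκ hz fun v => by
    have := h2 v
    rwa [PauliOp.syn_add, (isHypercycle_cycle2 hκ v).syn_gauge hκ.isProper hg, zero_add] at this
  exact ⟨A, hA, by rw [add_assoc]; exact add_mem hg h⟩

end Fintype

end EmbGraph

theorem mainTheorem8 {F : Type*} [Fintype F] (M : EmbGraph F)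
    (hdeg : ∀ v, Even (M.degree v) ∧ 2 < M.degree v) (hbi : M.Bicolorable)
    (κ : F → Bool) (hκ : M.IsInnerColoring κ) :
    -- the cycles of the five types are hypercycles, and their operators are stabilizers
    (∀ f, IsHypercycle (M.fiveSquares κ) (M.cycle1 f) ∧
      IsStabilizer (M.fiveSquares κ) (cycleOp (M.cycle1 f))) ∧
    (∀ v, IsHypercycle (M.fiveSquares κ) (M.cycle2 κ v) ∧
      IsStabilizer (M.fiveSquares κ) (cycleOp (M.cycle2 κ v))) ∧
    (∀ f, IsHypercycle (M.fiveSquares κ) (M.cycle3 κ f) ∧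
      IsStabilizer (M.fiveSquares κ) (cycleOp (M.cycle3 κ f))) ∧
    (∀ v, IsHypercycle (M.fiveSquares κ) (M.cycle4 κ v) ∧
      IsStabilizer (M.fiveSquares κ) (cycleOp (M.cycle4 κ v))) ∧
    (∀ c, IsHypercycle (M.fiveSquares κ) (M.cycle5 c) ∧
      IsStabilizer (M.fiveSquares κ) (cycleOp (M.cycle5 c))) ∧
    -- a pattern of residual qubits exists
    (∃ Ω, M.IsResidualPattern Ω) ∧
    -- there is a partition of the faces of `M` such that, for every such pattern:
    ∃ Fa Fb : Set M.Face, IsCompl Fa Fb ∧ ∀ Ω, M.IsResidualPattern Ω →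
      -- once the `X` errors and the errors on rank-3 edges are corrected, every error is
      -- equivalent to a `Z` error on the pattern
      (∀ E : PauliOp M.Qubit,
        (∀ v, PauliOp.syn (cycleOp (M.cycle2 κ v)) E = 0) →
        (∀ v, PauliOp.syn (cycleOp (M.cycle4 κ v)) E = 0) →
        (∀ c, PauliOp.syn (cycleOp (M.cycle5 c)) E = 0) →
        ∃ A ⊆ Ω, E + M.residualError A ∈ gaugeGroup (M.fiveSquares κ)) ∧
      -- every single residual `Z` error flips exactly one S1 and exactly one S3 stabilizer, on
      -- distinct faces that are joined by the projected edge of the dual graph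
      (∀ x ∈ Ω, ∃ f f' : M.Face, f ≠ f' ∧ M.dual.Joins (M.dual.edgeOf x) f f' ∧
        (∀ g, PauliOp.syn (cycleOp (M.cycle1 g)) (M.residualError {x}) = 1 ↔ g = f) ∧
        (∀ g, PauliOp.syn (cycleOp (M.cycle3 κ g)) (M.residualError {x}) = 1 ↔ g = f')) ∧
      -- the pattern splits into two parts, each being a copy of the edge set of the dual graph
      ∃ Ωa Ωb : Finset F, Ωa ∪ Ωb = Ω ∧ Disjoint Ωa Ωb ∧
        Set.BijOn M.dual.edgeOf Ωa Set.univ ∧ Set.BijOn M.dual.edgeOf Ωb Set.univ ∧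
        -- qubits in the first part participate in S1 checks on `Fa` and S3 checks on `Fb` only,
        -- those in the second part in S3 checks on `Fa` and S1 checks on `Fb` only
        (∀ x ∈ Ωa, ∀ f,
          (PauliOp.syn (cycleOp (M.cycle1 f)) (M.residualError {x}) = 1 → f ∈ Fa) ∧
          (PauliOp.syn (cycleOp (M.cycle3 κ f)) (M.residualError {x}) = 1 → f ∈ Fb)) ∧
        (∀ x ∈ Ωb, ∀ f,
          (PauliOp.syn (cycleOp (M.cycle1 f)) (M.residualError {x}) = 1 → f ∈ Fb) ∧
          (PauliOp.syn (cycleOp (M.cycle3 κ f)) (M.residualError {x}) = 1 → f ∈ Fa)) ∧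
        -- the syndromes of a residual error are the vertex syndromes of its two projections
        (∀ A ⊆ Ω,
          (∀ f ∈ Fa,
            PauliOp.syn (cycleOp (M.cycle1 f)) (M.residualError A) =
              PauliOp.syn (M.dual.vertexOp f) (M.projectedError (A ∩ Ωa)) ∧
            PauliOp.syn (cycleOp (M.cycle3 κ f)) (M.residualError A) =
              PauliOp.syn (M.dual.vertexOp f) (M.projectedError (A ∩ Ωb))) ∧
          (∀ f ∈ Fb,
            PauliOp.syn (cycleOp (M.cycle3 κ f)) (M.residualError A) =
              PauliOp.syn (M.dual.vertexOp f) (M.projectedError (A ∩ Ωa)) ∧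
            PauliOp.syn (cycleOp (M.cycle1 f)) (M.residualError A) =
              PauliOp.syn (M.dual.vertexOp f) (M.projectedError (A ∩ Ωb)))) ∧
        -- if the estimates `Da`, `Db` correct the projections on the two surface codes, then their
        -- lift corrects the residual error
        (∀ A ⊆ Ω, ∀ Da Db : Finset M.dual.Edge,
          M.projectedError (A ∩ Ωa) + zOn Da ∈ M.dual.surfaceStabilizer →
          M.projectedError (A ∩ Ωb) + zOn Db ∈ M.dual.surfaceStabilizer →
          M.residualError A + M.residualError (M.lift Ωa Da ∪ M.lift Ωb Db) ∈
            gaugeGroup (M.fiveSquares κ)) := by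
  obtain ⟨c, hc⟩ := hbi.exists_coloring
  refine ⟨fun f => ⟨EmbGraph.isHypercycle_cycle1 hκ f, EmbGraph.isStabilizer_cycle1 hκ f⟩,
    fun v => ⟨EmbGraph.isHypercycle_cycle2 hκ v, EmbGraph.isStabilizer_cycle2 hκ v⟩,
    fun f => ⟨EmbGraph.isHypercycle_cycle3 hbi hκ f, EmbGraph.isStabilizer_cycle3 hbi hκ f⟩,
    fun v => ⟨EmbGraph.isHypercycle_cycle4 hκ v, EmbGraph.isStabilizer_cycle4 hκ v⟩,
    fun d => ⟨EmbGraph.isHypercycle_cycle5 hκ d, EmbGraph.isStabilizer_cycle5 hκ d⟩,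
    -- The partition is the bicolouring itself, which does not depend on `Ω`.
    M.exists_isResidualPattern, {f | c f = true}, {f | c f = false}, ?_, fun Ω hΩ => ?_⟩
  · have h : {f | c f = false} = {f | c f = true}ᶜ := by
      ext f
      simp
    rw [h]
    exact isCompl_compl
  have h1 : ∀ x g, PauliOp.syn (cycleOp (M.cycle1 g)) (M.residualError {x}) = 1 ↔
      g = M.faceOf x := by
    intro x g
    rw [EmbGraph.syn_cycle1_residualError hκ, Finset.sum_singleton]
    simp [eq_comm]
  have h3 : ∀ x g, PauliOp.syn (cycleOp (M.cycle3 κ g)) (M.residualError {x}) = 1 ↔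
      g = M.faceOf (M.τ2 x) := by
    intro x g
    rw [EmbGraph.syn_cycle3_residualError hbi hκ, Finset.sum_singleton]
    simp [eq_comm]
  have hτ2 : ∀ x, c (M.faceOf (M.τ2 x)) = !c (M.faceOf x) := hc.τ2
  refine ⟨fun E h2 h4 h5 => hΩ.exists_equivalent hκ h2 h4 h5,
    fun x _ => ⟨M.faceOf x, M.faceOf (M.τ2 x), hbi.faceOf_ne x, ⟨x, rfl, rfl, rfl⟩, h1 x, h3 x⟩,
    Ω.filter fun x => c (M.faceOf x) = true, Ω.filter fun x => c (M.faceOf x) = false,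
    ?_, ?_, hΩ.bijOn_edgeOf hc true, hΩ.bijOn_edgeOf hc false, ?_, ?_, ?_, ?_⟩
  · ext x
    cases h : c (M.faceOf x) <;> simp [h]
  · rw [Finset.disjoint_filter]
    simp +contextual
  · intro x hx f
    have hx' := (Finset.mem_filter.1 hx).2
    rw [h1, h3]
    constructor <;> rintro rfl <;> simp [hx', hτ2]
  · intro x hx f
    have hx' := (Finset.mem_filter.1 hx).2
    rw [h1, h3]
    constructor <;> rintro rfl <;> simp [hx', hτ2]
  · refine fun A hA => ⟨fun f hf => ?_, fun f hf => ?_⟩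
    all_goals
      have hf' : c f = _ := hf
      have e1 := hΩ.syn_cycle1 hκ hc (f := f) hA
      have e3 := hΩ.syn_cycle3 hbi hκ hc (f := f) hA
      simp only [hf', Bool.not_true, Bool.not_false] at e1 e3
    · exact ⟨e1, e3⟩
    · exact ⟨e3, e1⟩
  · intro A hA Da Db ha hb
    have hdisj : Disjoint (Ω.filter fun x => c (M.faceOf x) = true)
        (Ω.filter fun x => c (M.faceOf x) = false) := by
      rw [Finset.disjoint_filter]
      simp +contextual
    have hlift : Disjoint (M.lift (Ω.filter fun x => c (M.faceOf x) = true) Da)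
        (M.lift (Ω.filter fun x => c (M.faceOf x) = false) Db) :=
      hdisj.mono (Finset.filter_subset _ _) (Finset.filter_subset _ _)
    have hA' : A = (A ∩ Ω.filter fun x => c (M.faceOf x) = true) ∪
        (A ∩ Ω.filter fun x => c (M.faceOf x) = false) := by
      ext x
      have := @hA x
      cases h : c (M.faceOf x) <;> simp [h] <;> tauto
    have ha' := hΩ.mkQ_residualError_eq hκ hc true ha
    have hb' := hΩ.mkQ_residualError_eq hκ hc false hb
    simp only [EmbGraph.mkQ_residualError] at ha' hb'
    rw [← EmbGraph.mkQ_gaugeModule, map_add, EmbGraph.mkQ_residualError,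
      EmbGraph.mkQ_residualError, Finset.sum_union hlift, ← ha', ← hb', ← Finset.sum_union
        (hdisj.mono Finset.inter_subset_right Finset.inter_subset_right), ← hA']
    exact ZModModule.add_self _
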